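/- Let $s=\sigma+it$ with $0<\sigma<1$ and $t\ge 0$, let $0<\alpha\le 1$, $x>0$, $0<\eta<1$, and put $y=\dfrac{t}{2\pi x}$. Let $\psi(u)=u-[u]-\tfrac12$ and let $\zeta(s,\alpha)$ be the Hurwitz zeta function. In all sums $n$ and $\nu$ are integers. Then $$\zeta(s,\alpha)=\sum_{0\le n\le x-\alpha}(n+\alpha)^{-s}+i(2\pi)^{s-1}\Gamma(1-s)e^{-\pi i s/2}\sum_{1\le n\le y}e^{-2\pi i n\alpha}n^{s-1}+E_1,$$ where $E_1-\dfrac{x^{1-s}}{s-1}=K_1+K_2$ with $$\begin{aligned}K_1={}&x^{-s}\Big(\psi(x-\alpha)+\sum_{1\le\nu\le y}\frac{e^{2\pi i\nu(x-\alpha)}}{2\pi i\nu}\Big)+\sum_{\nu\ge1,\ \nu\ge y+\eta}\frac{s}{2\pi i\nu}\int_x^\infty\frac{e^{2\pi i\nu(u-\alpha)}}{u^{s+1}}\,du\\&-\sum_{1\le\nu\le y-\eta}\int_0^x\frac{e^{2\pi i\nu(u-\alpha)}}{u^s}\,du-\sum_{\nu\ge1}\frac{s}{2\pi i\nu}\int_x^\infty\frac{e^{-2\pi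 i\nu(u-\alpha)}}{u^{s+1}}\,du,\end{aligned}$$ $$K_2=\sum_{\nu\ge 1,\ y<\nu<y+\eta}\frac{s}{2\pi i\nu}\int_x^\infty\frac{e^{2\pi i\nu(u-\alpha)}}{u^{s+1}}\,du-\sum_{\nu\ge 1,\ y-\eta<\nu\le y}\int_0^x\frac{e^{2\pi i\nu(u-\alpha)}}{u^s}\,du,$$ all integrals and infinite series being absolutely convergent. In addition, if $y=\nu_0\ge1$ is an integer, then also $E_1-\dfrac{x^{1-s}}{s-1}=K_1+K_2$ with $$\begin{aligned}K_1={}&x^{-s}\Big(\psi(x-\alpha)+\sum_{1\le\nu\le\nu_0}\frac{e^{2\pi i\nu(x-\alpha)}}{2\pi i\nu}\Big)+\sum_{\nu\ge\nu_0+1}\frac{s}{2\pi i\nu}\int_x^\infty\frac{e^{2\pi i\nu(u-\alpha)}}{u^{s+1}}\,du\\&-\sum_{1\le\nu\le\nu_0-1}\int_0^x\frac{e^{2\pi i\nu(u-\alpha)}}{u^s}\,du-\sum_{\nu\ge1}\frac{s}{2\pi i\nu}\int_x^\infty\frac{e^{-2\pi i\nu(u-\alpha)}}{u^{s+1}}\,du,\end{aligned}$$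 $$K_2=-\int_0^x\frac{e^{2\pi i\nu_0(u-\alpha)}}{u^s}\,du .$$ Finally, for all $c>0$ and $0<\eta<1$ there is a constant $C$ depending only on $c$ and $\eta$ such that, whenever $x\ge c$ and $y\ge c$, $$|K_1|\le C\,x^{-\sigma}\log(t+2)\qquad\text{and}\qquad |K_2|\le C\,\frac{x^{1-\sigma}}{\sqrt t},$$ uniformly in $0<\sigma<1$ and $0<\alpha\le1$; for the special form with $y=\nu_0$ an integer and $x\ge c$ the same bounds hold with $C$ depending only on $c$. -/

import Mathlib

open scoped Real

noncomputable section

namespace HurwitzAFE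

/-- The sawtooth function `ψ(u) = u - [u] - 1/2`. -/
def psi (u : ℝ) : ℝ := u - (⌊u⌋ : ℝ) - 1 / 2

/-- The function `u ↦ e^{2πiν(u-α)} / u^w` of a real variable `u`. -/
def wave (α : ℝ) (ν : ℤ) (w : ℂ) (u : ℝ) : ℂ :=
  Complex.exp (2 * (π : ℂ) * Complex.I * (ν : ℂ) * ((u : ℂ) - (α : ℂ))) / (u : ℂ) ^ w

/-- `s / (2πiν) * ∫_x^∞ e^{2πiν(u-α)} / u^{s+1} du`, for `ν ≥ 1`. -/
def upperTerm (s : ℂ) (α x : ℝ) (ν : ℕ) : ℂ :=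
  s / (2 * (π : ℂ) * Complex.I * (ν : ℂ)) * ∫ u in Set.Ioi x, wave α (ν : ℤ) (s + 1) u

/-- `s / (2πiν) * ∫_x^∞ e^{-2πiν(u-α)} / u^{s+1} du`, for `ν ≥ 1`. -/
def upperTermNeg (s : ℂ) (α x : ℝ) (ν : ℕ) : ℂ :=
  s / (2 * (π : ℂ) * Complex.I * (ν : ℂ)) * ∫ u in Set.Ioi x, wave α (-(ν : ℤ)) (s + 1) u

/-- `∫_0^x e^{2πiν(u-α)} / u^s du`, for `ν ≥ 1`. -/
def lowerTerm (s : ℂ) (α x : ℝ) (ν : ℕ) : ℂ :=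
  ∫ u in (0 : ℝ)..x, wave α (ν : ℤ) s u

/-- The sum `∑_{0 ≤ n ≤ x - α} (n + α)^{-s}`. -/
def mainSum (s : ℂ) (α x : ℝ) : ℂ :=
  ∑ n ∈ Finset.Icc (0 : ℤ) ⌊x - α⌋, ((n : ℂ) + (α : ℂ)) ^ (-s)

/-- `i (2π)^{s-1} Γ(1-s) e^{-πis/2} ∑_{1 ≤ n ≤ y} e^{-2πinα} n^{s-1}`. -/
def dualSum (s : ℂ) (α y : ℝ) : ℂ :=
  Complex.I * (2 * (π : ℂ)) ^ (s - 1) * Complex.Gamma (1 - s) *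
    Complex.exp (-((π : ℂ) * Complex.I * s / 2)) *
    ∑ n ∈ Finset.Icc 1 ⌊y⌋₊,
      Complex.exp (-(2 * (π : ℂ) * Complex.I * (n : ℂ) * (α : ℂ))) * (n : ℂ) ^ (s - 1)

/-- `x^{-s} (ψ(x-α) + ∑_{1 ≤ ν ≤ N} e^{2πiν(x-α)} / (2πiν))`. -/
def boundaryTerm (s : ℂ) (α x : ℝ) (N : ℕ) : ℂ :=
  (x : ℂ) ^ (-s) * ((psi (x - α) : ℂ) +
    ∑ ν ∈ Finset.Icc 1 N,
      Complex.exp (2 * (π : ℂ) * Complex.I * (ν : ℂ) * ((x : ℂ) - (α : ℂ))) /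
        (2 * (π : ℂ) * Complex.I * (ν : ℂ)))

/-- The remainder `K₁`: the boundary term with `1 ≤ ν ≤ y`, plus the upper terms with
`ν ≥ y + η`, minus the lower terms with `1 ≤ ν ≤ y - η`, minus all negative upper terms. -/
def K1 (s : ℂ) (α x y η : ℝ) : ℂ :=
  boundaryTerm s α x ⌊y⌋₊
    + (∑' ν : {ν : ℕ // 1 ≤ ν ∧ y + η ≤ (ν : ℝ)}, upperTerm s α x ν)
    - (∑ ν ∈ Finset.Icc 1 ⌊y⌋₊ with ((ν : ℕ) : ℝ) ≤ y - η, lowerTerm s α x ν)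
    - ∑' ν : {ν : ℕ // 1 ≤ ν}, upperTermNeg s α x ν

/-- The remainder `K₂`: the upper terms with `y < ν < y + η` minus the lower terms with
`y - η < ν ≤ y`, over integers `ν ≥ 1`. -/
def K2 (s : ℂ) (α x y η : ℝ) : ℂ :=
  (∑ ν ∈ Finset.Icc 1 ⌈y + η⌉₊ with y < ((ν : ℕ) : ℝ) ∧ ((ν : ℕ) : ℝ) < y + η,
      upperTerm s α x ν)
    - ∑ ν ∈ Finset.Icc 1 ⌊y⌋₊ with y - η < ((ν : ℕ) : ℝ), lowerTerm s α x ν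

/-- The form of `K₁` when `y = ν₀` is a positive integer. -/
def K1Int (s : ℂ) (α x : ℝ) (ν₀ : ℕ) : ℂ :=
  boundaryTerm s α x ν₀
    + (∑' ν : {ν : ℕ // ν₀ + 1 ≤ ν}, upperTerm s α x ν)
    - (∑ ν ∈ Finset.Icc 1 (ν₀ - 1), lowerTerm s α x ν)
    - ∑' ν : {ν : ℕ // 1 ≤ ν}, upperTermNeg s α x ν

/-- The form of `K₂` when `y = ν₀` is a positive integer. -/
def K2Int (s : ℂ) (α x : ℝ) (ν₀ : ℕ) : ℂ := -lowerTerm s α x ν₀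

end HurwitzAFE

end

/-!
Write `e(v) = exp (2πiv)`. The remainder comes from the Fourier expansion of the sawtooth function
in the Euler–Maclaurin formula.

For `Re s > 0`, `s ≠ 1`, the Euler–Maclaurin formula says that `ζ(s, α)` is
`∑_{n ≤ x - α} (n + α)^{-s} + x^{1-s} / (s - 1) + ψ(x - α) x^{-s} - s ∫_x^∞ ψ(u - α) u^{-s-1} du`.
Expanding `ψ` in its Fourier series turns the last integral into the sum of all upper terms of
positive frequency minus all those of negative frequency (`hurwitzZeta_eq_add_tsum`). The Fourier
series of `ψ` converges only conditionally, so the formula is carried one order further, to the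
continuous function `B₂({v})` with its absolutely convergent cosine series, and the termwise
integrations by parts undo that step. The formula is proved for `Re s > 1` by summing over unit
intervals, and continued analytically (`hurwitzZeta_eq_eulerMaclaurinTwo`).

For a frequency `1 ≤ ν ≤ y` the upper term is integrated by parts back to `∫_x^∞ e(νu) u^{-s} du`,
which is the complete integral over `(0, ∞)`, a Gamma factor that gives the `ν`-th term of the dual
sum, minus the integral over `(0, x)` (`upperTerm_eq`). The Gamma integral on the imaginary axis is
the boundary value of `∫_0^∞ u^{-s} e^{-ru} du = r^{s-1} Γ(1 - s)`, `Re r > 0`. This gives the exact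
identity `hurwitzZeta_sub_eq_K1_add_K2`.

The bounds are first and second derivative tests for the phase `2πνu - t log u`, whose derivative
at `x` is `2π(ν - y)`. Because `u^{1-κ} / (2πνu - t)` (amplitude `u^{-κ}` over derivative of the
phase) is monotone, one integration by parts bounds an integral by twice the endpoint values of
this quotient (`norm_integral_wave_le`). At distance at least `η` from `y` this gives
`O(x^{-σ} / |ν - y|)` for lower terms and `O(x^{-σ} y / (ν |ν - y|))` for upper terms, and
`∑_k y / ((k + 1)(y + k)) ≤ 1 + log (1 + y)` by telescoping. At most one frequency on each side lies
within `η < 1` of `y`; there a piece of length about `x / √t` next to the endpoint `x`, which is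
near the stationary point, is estimated trivially, and the rest by the first derivative test.
When `y = ν₀` is an integer, the special form is the general one with `η = 1 / 2`.
-/

namespace HurwitzAFE

open MeasureTheory Set Filter Topology

/-! ### Waves and the first derivative test -/

lemma norm_exp_phase (α : ℝ) (ν : ℤ) (u : ℝ) :
    ‖Complex.exp (2 * (π : ℂ) * Complex.I * (ν : ℂ) * ((u : ℂ) - (α : ℂ)))‖ = 1 := by
  have h : 2 * (π : ℂ) * Complex.I * (ν : ℂ) * ((u : ℂ) - (α : ℂ))
      = ((2 * π * ν * (u - α) : ℝ) : ℂ) * Complex.I := by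
    push_cast; ring
  rw [h, Complex.norm_exp_ofReal_mul_I]

lemma wave_eq_mul_cpow (α : ℝ) (ν : ℤ) (w : ℂ) (u : ℝ) :
    wave α ν w u =
      Complex.exp (2 * (π : ℂ) * Complex.I * (ν : ℂ) * ((u : ℂ) - (α : ℂ))) * (u : ℂ) ^ (-w) := by
  rw [wave, Complex.cpow_neg, div_eq_mul_inv]

lemma norm_wave (α : ℝ) (ν : ℤ) (w : ℂ) {u : ℝ} (hu : 0 < u) :
    ‖wave α ν w u‖ = u ^ (-w.re) := by
  rw [wave_eq_mul_cpow, norm_mul, norm_exp_phase, one_mul, Complex.norm_cpow_eq_rpow_re_of_pos hu,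
    Complex.neg_re]

lemma wave_eq_mul_wave_add_one (α : ℝ) (ν : ℤ) (w : ℂ) {u : ℝ} (hu : 0 < u) :
    wave α ν w u = u * wave α ν (w + 1) u := by
  have hu' : (u : ℂ) ≠ 0 := by exact_mod_cast hu.ne'
  rw [wave, wave, Complex.cpow_add _ _ hu', Complex.cpow_one]
  have : (u : ℂ) ^ w ≠ 0 := by simp [Complex.cpow_eq_zero_iff, hu']
  field_simp

lemma integrableOn_wave_Ioi (α : ℝ) (ν : ℤ) {w : ℂ} (hw : 1 < w.re) {x : ℝ} (hx : 0 < x) :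
    IntegrableOn (wave α ν w) (Ioi x) := by
  have h1 : IntegrableOn (fun u : ℝ => (u : ℂ) ^ (-w)) (Ioi x) :=
    integrableOn_Ioi_cpow_of_lt (by simpa using hw) hx
  have h2 : IntegrableOn (fun u : ℝ =>
      Complex.exp (2 * (π : ℂ) * Complex.I * (ν : ℂ) * ((u : ℂ) - (α : ℂ))) * (u : ℂ) ^ (-w))
      (Ioi x) := by
    refine Integrable.bdd_mul (c := 1) h1 ?_ ?_
    · exact Continuous.aestronglyMeasurable (by fun_prop)
    · exact Eventually.of_forall fun u => (norm_exp_phase α ν u).le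
  exact h2.congr_fun (fun u _ => (wave_eq_mul_cpow α ν w u).symm) measurableSet_Ioi

lemma intervalIntegrable_wave (α : ℝ) (ν : ℤ) {w : ℂ} (hw : w.re < 1) (a b : ℝ) :
    IntervalIntegrable (wave α ν w) volume a b := by
  have h1 : IntervalIntegrable (fun u : ℝ => (u : ℂ) ^ (-w)) volume a b :=
    intervalIntegral.intervalIntegrable_cpow' (by simpa using hw)
  have h2 := h1.continuousOn_mul (g := fun u : ℝ =>
      Complex.exp (2 * (π : ℂ) * Complex.I * (ν : ℂ) * ((u : ℂ) - (α : ℂ))))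
      (Continuous.continuousOn (by fun_prop))
  exact h2.congr (fun u _ => (wave_eq_mul_cpow α ν w u).symm)

lemma hasDerivAt_wave (α : ℝ) (ν : ℤ) (w : ℂ) {u : ℝ} (hu : 0 < u) :
    HasDerivAt (wave α ν w)
      (2 * (π : ℂ) * Complex.I * (ν : ℂ) * wave α ν w u - w * wave α ν (w + 1) u) u := by
  have h1 : HasDerivAt (fun z : ℂ =>
      Complex.exp (2 * (π : ℂ) * Complex.I * (ν : ℂ) * (z - (α : ℂ))) * z ^ (-w))
      (2 * (π : ℂ) * Complex.I * (ν : ℂ) * wave α ν w u - w * wave α ν (w + 1) u) (u : ℂ) := by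
    have he := (((hasDerivAt_id (u : ℂ)).sub_const (α : ℂ)).const_mul
      (2 * (π : ℂ) * Complex.I * (ν : ℂ))).cexp
    have hp := (hasDerivAt_id (u : ℂ)).cpow_const (c := -w) (Or.inl (by simpa using hu))
    have := he.mul hp
    convert! this using 1
    rw [wave_eq_mul_cpow, wave_eq_mul_cpow, neg_add']
    simp
    ring
  have h2 := h1.comp_ofReal
  refine h2.congr_of_eventuallyEq (Eventually.of_forall fun v => ?_)
  rw [wave_eq_mul_cpow]

lemma continuousOn_wave (α : ℝ) (ν : ℤ) (w : ℂ) : ContinuousOn (wave α ν w) (Ioi 0) :=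
  fun _ hu => (hasDerivAt_wave α ν w hu).continuousAt.continuousWithinAt

/-- The amplitude of `wave α ν w` divided by the derivative `2πν - Im w / u` of its phase. -/
noncomputable def phaseQuotient (ν : ℤ) (w : ℂ) (u : ℝ) : ℝ := u ^ (1 - w.re) / (2 * π * ν * u - w.im)

lemma hasDerivAt_phaseQuotient (ν : ℤ) (w : ℂ) {u : ℝ} (hu : 0 < u)
    (hne : 2 * π * ν * u - w.im ≠ 0) :
    HasDerivAt (phaseQuotient ν w)
      (-(u ^ (-w.re) * (w.re * (2 * π * ν * u) + (1 - w.re) * w.im)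
        / (2 * π * ν * u - w.im) ^ 2)) u := by
  have h1 := Real.hasDerivAt_rpow_const (x := u) (p := 1 - w.re) (Or.inl hu.ne')
  have h2 := ((hasDerivAt_id u).const_mul (2 * π * ν)).sub_const w.im
  have h := h1.div h2 hne
  convert! h using 1
  rw [show (1 - w.re - 1) = -w.re by ring, show u ^ (1 - w.re) = u * u ^ (-w.re) by
    rw [sub_eq_add_neg, Real.rpow_add hu, Real.rpow_one]]
  simp only [id]
  ring

/-- First derivative test: `wave α ν w` is the derivative of a function of absolute value
`|phaseQuotient ν w|`, up to an error of absolute value `|(phaseQuotient ν w)'|`. The sign condition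
makes `phaseQuotient ν w` monotone, so that the error integrates to a difference of endpoint values. -/
lemma norm_integral_wave_le {α : ℝ} {ν : ℤ} {w : ℂ} {a b : ℝ} (ha : 0 < a) (hab : a ≤ b)
    (hne : ∀ u ∈ Icc a b, 2 * π * ν * u - w.im ≠ 0)
    (hD : (∀ u ∈ Icc a b, 0 ≤ w.re * (2 * π * ν * u) + (1 - w.re) * w.im) ∨
      (∀ u ∈ Icc a b, w.re * (2 * π * ν * u) + (1 - w.re) * w.im ≤ 0)) :
    ‖∫ u in a..b, wave α ν w u‖ ≤ 2 * (|phaseQuotient ν w a| + |phaseQuotient ν w b|) := by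
  have hpos : ∀ u ∈ Icc a b, 0 < u := fun u hu => lt_of_lt_of_le ha hu.1
  set D : ℝ → ℝ := fun u => w.re * (2 * π * ν * u) + (1 - w.re) * w.im with hDdef
  -- `H` is `-i` times `phaseQuotient` times the unimodular factor of the wave; its derivative is
  -- the wave plus the error `R`, and `|R| = |r|` with `r = -(phaseQuotient ν w)'`
  set H : ℝ → ℂ := fun u => (u : ℂ) * wave α ν w u / (Complex.I * (2 * π * ν * u - w.im)) with hH
  set R : ℝ → ℂ := fun u =>
    Complex.I * D u / (2 * π * ν * u - w.im) ^ 2 * wave α ν w u with hR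
  set r : ℝ → ℝ := fun u => u ^ (-w.re) * D u / (2 * π * ν * u - w.im) ^ 2 with hr
  have hneC : ∀ u ∈ Icc a b, (2 * π * ν * u - w.im : ℂ) ≠ 0 := fun u hu => by
    exact_mod_cast hne u hu
  have hHn : ∀ u ∈ Icc a b, ‖H u‖ = |phaseQuotient ν w u| := by
    intro u hu
    have hu0 := hpos u hu
    rw [hH, phaseQuotient]
    simp only [norm_div, norm_mul, norm_wave α ν w hu0, Complex.norm_I, one_mul,
      Complex.norm_real, Real.norm_eq_abs, abs_div]
    rw [show (2 * π * ν * u - w.im : ℂ) = ((2 * π * ν * u - w.im : ℝ) : ℂ) by push_cast; ring,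
      Complex.norm_real, Real.norm_eq_abs, abs_of_pos hu0, abs_of_pos (Real.rpow_pos_of_pos hu0 _),
      sub_eq_add_neg 1, Real.rpow_add hu0, Real.rpow_one]
  have hHd : ∀ u ∈ Icc a b, HasDerivAt H (wave α ν w u + R u) u := by
    intro u hu
    have hu0 := hpos u hu
    have hden := hneC u hu
    have h1 := (hasDerivAt_id u).ofReal_comp.mul (hasDerivAt_wave α ν w hu0)
    have h2 := (((hasDerivAt_id u).ofReal_comp.const_mul (2 * π * ν : ℂ)).sub_const
      (w.im : ℂ)).const_mul Complex.I
    have h := h1.div h2 (by simpa using hden)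
    convert! h using 1
    have hw : w = w.re + w.im * Complex.I := (Complex.re_add_im w).symm
    simp only [hR, hDdef, id, Complex.ofReal_one, Pi.mul_apply]
    rw [wave_eq_mul_wave_add_one α ν w hu0]
    push_cast
    rw [mul_pow, Complex.I_sq, div_mul_eq_mul_div, add_div' _ _ _ (pow_ne_zero 2 hden),
      div_eq_div_iff (pow_ne_zero 2 hden) (by simpa using hden)]
    generalize wave α ν (w + 1) u = W
    generalize w.re = κ at hw ⊢
    generalize w.im = t at hw ⊢
    rw [hw]
    linear_combination (-(u : ℂ) * W * (2 * π * ν * u - t) ^ 4) * Complex.I_sq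
  have hRn : ∀ u ∈ Icc a b, ‖R u‖ = |r u| := by
    intro u hu
    have hu0 := hpos u hu
    simp only [hR, hr, norm_mul, norm_div, norm_pow, norm_wave α ν w hu0, Complex.norm_I, one_mul,
      Complex.norm_real, Real.norm_eq_abs, abs_div, abs_mul, abs_pow]
    rw [show (2 * π * ν * u - w.im : ℂ) = ((2 * π * ν * u - w.im : ℝ) : ℂ) by push_cast; ring,
      Complex.norm_real, Real.norm_eq_abs, abs_of_pos (Real.rpow_pos_of_pos hu0 _)]
    ring
  have hcr : ContinuousOn r (uIcc a b) := by
    rw [uIcc_of_le hab]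
    refine ContinuousOn.div ?_ (by fun_prop) fun u hu => pow_ne_zero 2 (hne u hu)
    refine ContinuousOn.mul ?_ (by fun_prop)
    exact fun u hu => (Real.continuousAt_rpow_const _ _ (Or.inl (hpos u hu).ne')).continuousWithinAt
  have hcw : ContinuousOn (wave α ν w) (uIcc a b) := by
    rw [uIcc_of_le hab]
    exact (continuousOn_wave α ν w).mono hpos
  have hcR : ContinuousOn R (uIcc a b) := by
    refine ContinuousOn.mul ?_ hcw
    rw [uIcc_of_le hab]
    refine ContinuousOn.div (by fun_prop) (by fun_prop) fun u hu => pow_ne_zero 2 (hneC u hu)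
  have hFTC := intervalIntegral.integral_eq_sub_of_hasDerivAt
    (fun u hu => hHd u (by rwa [uIcc_of_le hab] at hu)) (hcw.add hcR).intervalIntegrable
  have hFTCr := intervalIntegral.integral_eq_sub_of_hasDerivAt (f := phaseQuotient ν w)
    (fun u hu => hasDerivAt_phaseQuotient ν w (hpos u (by rwa [uIcc_of_le hab] at hu))
      (hne u (by rwa [uIcc_of_le hab] at hu))) hcr.neg.intervalIntegrable
  rw [intervalIntegral.integral_neg] at hFTCr
  have hRint : ‖∫ u in a..b, R u‖ ≤ |phaseQuotient ν w b - phaseQuotient ν w a| := by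
    have hle : ‖∫ u in a..b, R u‖ ≤ ∫ u in a..b, |r u| := by
      refine intervalIntegral.norm_integral_le_of_norm_le hab ?_ hcr.abs.intervalIntegrable
      exact Eventually.of_forall fun u hu => (hRn u (Ioc_subset_Icc_self hu)).le
    refine hle.trans ?_
    rw [← hFTCr, abs_neg]
    rcases hD with hD | hD
    · rw [intervalIntegral.integral_congr (g := r)]
      · exact le_abs_self _
      · intro u hu
        rw [uIcc_of_le hab] at hu
        refine abs_of_nonneg ?_
        have := hD u hu
        have := (Real.rpow_pos_of_pos (hpos u hu) (-w.re)).le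
        positivity
    · rw [intervalIntegral.integral_congr (g := fun u => -r u)]
      · rw [intervalIntegral.integral_neg]; exact neg_le_abs _
      · intro u hu
        rw [uIcc_of_le hab] at hu
        refine abs_of_nonpos ?_
        have h1 := hD u hu
        have h2 := (Real.rpow_pos_of_pos (hpos u hu) (-w.re)).le
        exact div_nonpos_of_nonpos_of_nonneg (mul_nonpos_of_nonneg_of_nonpos h2 h1) (sq_nonneg _)
  rw [intervalIntegral.integral_add hcw.intervalIntegrable hcR.intervalIntegrable] at hFTC
  have heq : ∫ u in a..b, wave α ν w u = H b - H a - ∫ u in a..b, R u := by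
    rw [← hFTC]; ring
  rw [heq]
  calc ‖H b - H a - ∫ u in a..b, R u‖ ≤ ‖H b‖ + ‖H a‖ + ‖∫ u in a..b, R u‖ :=
        (norm_sub_le _ _).trans (by gcongr; exact norm_sub_le _ _)
    _ ≤ |phaseQuotient ν w b| + |phaseQuotient ν w a| +
          (|phaseQuotient ν w b| + |phaseQuotient ν w a|) := by
        rw [hHn a (left_mem_Icc.2 hab), hHn b (right_mem_Icc.2 hab)]
        gcongr
        exact hRint.trans (abs_sub _ _)
    _ = _ := by ring

/-! ### Oscillatory integrals over infinite and singular ranges -/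

lemma norm_integral_Ioi_wave_le {α : ℝ} {ν : ℤ} {w : ℂ} {a : ℝ} (ha : 0 < a) (hw : 1 < w.re)
    (hν : ν ≠ 0) (hne : ∀ u, a ≤ u → 2 * π * ν * u - w.im ≠ 0)
    (hD : (∀ u, a ≤ u → 0 ≤ w.re * (2 * π * ν * u) + (1 - w.re) * w.im) ∨
      (∀ u, a ≤ u → w.re * (2 * π * ν * u) + (1 - w.re) * w.im ≤ 0)) :
    ‖∫ u in Ioi a, wave α ν w u‖ ≤ 2 * |phaseQuotient ν w a| := by
  have h1 := (intervalIntegral_tendsto_integral_Ioi a (integrableOn_wave_Ioi α ν hw ha)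
    tendsto_id).norm
  -- the amplitude tends to `0` and the derivative of the phase stays away from `0`
  have hq : Tendsto (phaseQuotient ν w) atTop (𝓝 0) := by
    have hn : Tendsto (fun u : ℝ => u ^ (1 - w.re)) atTop (𝓝 0) := by
      have := tendsto_rpow_neg_atTop (y := w.re - 1) (by linarith)
      simpa using this
    rcases lt_or_gt_of_ne hν with h | h
    · refine hn.div_atBot ?_
      refine tendsto_atBot_add_const_right _ _ (tendsto_id.const_mul_atTop_of_neg ?_)
      exact mul_neg_of_pos_of_neg Real.two_pi_pos (by exact_mod_cast h)
    · refine hn.div_atTop ?_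
      refine tendsto_atTop_add_const_right _ _ (tendsto_id.const_mul_atTop ?_)
      exact mul_pos Real.two_pi_pos (by exact_mod_cast h)
  have h2 : Tendsto (fun b => 2 * (|phaseQuotient ν w a| + |phaseQuotient ν w b|)) atTop
      (𝓝 (2 * (|phaseQuotient ν w a| + |(0 : ℝ)|))) := (hq.abs.const_add _).const_mul 2
  rw [abs_zero, add_zero] at h2
  refine le_of_tendsto_of_tendsto h1 h2 ?_
  filter_upwards [eventually_ge_atTop a] with b hb
  exact norm_integral_wave_le ha hb (fun u hu => hne u hu.1)
    (hD.imp (fun h u hu => h u hu.1) (fun h u hu => h u hu.1))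

lemma norm_integral_zero_wave_le {α : ℝ} {ν : ℤ} {w : ℂ} {b : ℝ} (hb : 0 < b) (hw : w.re < 1)
    (ht : w.im ≠ 0) (hne : ∀ u, 0 < u → u ≤ b → 2 * π * ν * u - w.im ≠ 0)
    (hD : ∀ u, 0 < u → u ≤ b → 0 ≤ w.re * (2 * π * ν * u) + (1 - w.re) * w.im) :
    ‖∫ u in (0 : ℝ)..b, wave α ν w u‖ ≤ 2 * |phaseQuotient ν w b| := by
  have hint := intervalIntegrable_wave α ν hw 0 b
  have h1 : Tendsto (fun a => ∫ u in a..b, wave α ν w u) (𝓝[>] 0)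
      (𝓝 (∫ u in (0 : ℝ)..b, wave α ν w u)) := by
    have hc : Tendsto (fun a => ∫ u in a..b, wave α ν w u) (𝓝[Icc 0 b] 0)
        (𝓝 (∫ u in (0 : ℝ)..b, wave α ν w u)) := by
      have := intervalIntegral.continuousOn_primitive_interval_left
        (f := wave α ν w) (μ := volume) (a := 0) (b := b)
        ((intervalIntegrable_iff' (by simp)).1 hint)
      rw [uIcc_of_le hb.le] at this
      exact this 0 (left_mem_Icc.2 hb.le)
    refine hc.mono_left ?_
    rw [← nhdsWithin_Ioc_eq_nhdsGT hb]
    exact nhdsWithin_mono _ Ioc_subset_Icc_self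
  -- near `0` the derivative of the phase behaves like `-Im w / u`, which outweighs `u ^ (-Re w)`
  have hq : Tendsto (phaseQuotient ν w) (𝓝[>] 0) (𝓝 0) := by
    have hc : ContinuousAt (phaseQuotient ν w) 0 := by
      refine ContinuousAt.div ?_ (by fun_prop) (by simpa using ht)
      exact Real.continuousAt_rpow_const _ _ (Or.inr (by linarith))
    have := hc.tendsto
    rw [phaseQuotient, Real.zero_rpow (by linarith), zero_div] at this
    exact this.mono_left nhdsWithin_le_nhds
  have h2 : Tendsto (fun a => 2 * (|phaseQuotient ν w a| + |phaseQuotient ν w b|)) (𝓝[>] 0)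
      (𝓝 (2 * (|(0 : ℝ)| + |phaseQuotient ν w b|))) := (hq.abs.add_const _).const_mul 2
  rw [abs_zero, zero_add] at h2
  refine le_of_tendsto_of_tendsto h1.norm h2 ?_
  filter_upwards [Ioc_mem_nhdsGT hb] with a ha
  exact norm_integral_wave_le ha.1 ha.2 (fun u hu => hne u (ha.1.trans_le hu.1) hu.2)
    (Or.inl fun u hu => hD u (ha.1.trans_le hu.1) hu.2)

section Estimates

variable {s : ℂ} {α x : ℝ} {ν : ℕ}

lemma norm_integral_wave_upper_le (hσ : 0 < s.re) (ht : 0 ≤ s.im) (hx : 0 < x)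
    (hν : s.im < 2 * π * ν * x) :
    ‖∫ u in Ioi x, wave α (ν : ℤ) (s + 1) u‖ ≤ 2 * (x ^ (-s.re) / (2 * π * ν * x - s.im)) := by
  have hν0 : ν ≠ 0 := by
    rintro rfl
    simp at hν
    linarith
  have hmono : ∀ u, x ≤ u → 2 * π * ν * x ≤ 2 * π * ν * u := fun u hu => by gcongr
  have h := norm_integral_Ioi_wave_le (α := α) (ν := (ν : ℤ)) (w := s + 1) hx (by simpa using hσ)
    (by exact_mod_cast hν0)
    (fun u hu => by
      have := hmono u hu
      simp only [Complex.add_im, Complex.one_im, add_zero, Int.cast_natCast]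
      linarith)
    (Or.inl fun u hu => by
      have := hmono u hu
      simp only [Complex.add_im, Complex.one_im, add_zero, Int.cast_natCast, Complex.add_re,
        Complex.one_re]
      nlinarith)
  refine h.trans (le_of_eq ?_)
  rw [phaseQuotient, abs_of_nonneg]
  · simp
  · have := Real.rpow_nonneg hx.le (1 - (s + 1).re)
    refine div_nonneg this ?_
    simp only [Complex.add_im, Complex.one_im, add_zero, Int.cast_natCast]
    linarith

lemma norm_integral_wave_upper_neg_le (hσ : 0 < s.re) (ht : 0 ≤ s.im) (hx : 0 < x) (hν : 1 ≤ ν) :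
    ‖∫ u in Ioi x, wave α (-(ν : ℤ)) (s + 1) u‖ ≤
      2 * (x ^ (-s.re) / (2 * π * ν * x + s.im)) := by
  have hν0 : (0 : ℝ) < ν := by exact_mod_cast hν
  have hpos : ∀ u, x ≤ u → 0 < 2 * π * ν * u := fun u hu => by
    have : 0 < u := hx.trans_le hu
    positivity
  have h := norm_integral_Ioi_wave_le (α := α) (ν := -(ν : ℤ)) (w := s + 1) hx (by simpa using hσ)
    (by simpa using (by omega : ν ≠ 0))
    (fun u hu => by
      have := hpos u hu
      simp only [Complex.add_im, Complex.one_im, add_zero, Int.cast_natCast, Int.cast_neg]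
      nlinarith)
    (Or.inr fun u hu => by
      have := hpos u hu
      simp only [Complex.add_im, Complex.one_im, add_zero, Int.cast_natCast, Complex.add_re,
        Complex.one_re, Int.cast_neg]
      nlinarith)
  refine h.trans (le_of_eq ?_)
  rw [phaseQuotient, abs_div, abs_of_nonneg (Real.rpow_nonneg hx.le _), abs_of_nonpos]
  · simp
    ring
  · have := hpos x le_rfl
    simp only [Complex.add_im, Complex.one_im, add_zero, Int.cast_natCast, Int.cast_neg]
    linarith

lemma norm_integral_wave_lower_le (hσ : 0 < s.re) (hσ1 : s.re < 1) (hx : 0 < x)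
    (hν : 2 * π * ν * x < s.im) :
    ‖∫ u in (0 : ℝ)..x, wave α (ν : ℤ) s u‖ ≤ 2 * (x ^ (1 - s.re) / (s.im - 2 * π * ν * x)) := by
  have hmono : ∀ u, u ≤ x → 2 * π * ν * u ≤ 2 * π * ν * x := fun u hu => by gcongr
  have hnn : 0 ≤ 2 * π * ν * x := by positivity
  have h := norm_integral_zero_wave_le (α := α) (ν := (ν : ℤ)) (w := s) hx hσ1 (by linarith)
    (fun u _ hu => by
      have := hmono u hu
      simp only [Int.cast_natCast]
      linarith)
    (fun u hu _ => by
      have : 0 ≤ 2 * π * ν * u := by positivity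
      simp only [Int.cast_natCast]
      nlinarith)
  refine h.trans (le_of_eq ?_)
  rw [phaseQuotient, abs_div, abs_of_nonneg (Real.rpow_nonneg hx.le _), abs_of_nonpos]
  · simp
  · simp only [Int.cast_natCast]
    linarith

end Estimates

/-! ### Frequencies close to the stationary one -/

section SecondDerivative

variable {s : ℂ} {α x y c : ℝ} {ν : ℕ}

lemma norm_upperTerm_eq (s : ℂ) (α x : ℝ) (ν : ℕ) :
    ‖upperTerm s α x ν‖ =
      ‖s‖ / (2 * π * ν) * ‖∫ u in Ioi x, wave α (ν : ℤ) (s + 1) u‖ := by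
  simp [upperTerm, abs_of_pos Real.pi_pos]

lemma norm_upperTermNeg_eq (s : ℂ) (α x : ℝ) (ν : ℕ) :
    ‖upperTermNeg s α x ν‖ =
      ‖s‖ / (2 * π * ν) * ‖∫ u in Ioi x, wave α (-(ν : ℤ)) (s + 1) u‖ := by
  simp [upperTermNeg, abs_of_pos Real.pi_pos]

lemma norm_le_one_add_im (hσ : 0 < s.re) (hσ1 : s.re < 1) (ht : 0 ≤ s.im) : ‖s‖ ≤ 1 + s.im := by
  refine (Complex.norm_le_abs_re_add_abs_im s).trans ?_
  rw [abs_of_pos hσ, abs_of_nonneg ht]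
  linarith

/-- An upper term whose stationary point `t / (2πν)` lies below `x`, however close. The piece
`[x, x + x / √t]` is estimated trivially. -/
lemma norm_upperTerm_le_near (hσ : 0 < s.re) (hσ1 : s.re < 1) (hc : 0 < c) (hx : 0 < x)
    (hct : c ^ 2 ≤ s.im) (hν : s.im < 2 * π * ν * x) :
    ‖upperTerm s α x ν‖ ≤ 3 * (1 + 1 / c ^ 2) * (x ^ (1 - s.re) / √s.im) := by
  set t := s.im with ht_def
  have ht : 0 < t := (by positivity : 0 < c ^ 2).trans_le hct
  have hr : 0 < √t := Real.sqrt_pos.2 ht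
  have hrr : √t * √t = t := Real.mul_self_sqrt ht.le
  have hν0 : (0 : ℝ) < ν := by
    rcases Nat.eq_zero_or_pos ν with rfl | h
    · simp at hν; linarith
    · exact_mod_cast h
  -- this length balances the trivial bound `δ x^{-σ-1}` against `x^{-σ} / (νδ)`, as `νx` is about `t`
  set δ := x / √t with hδ
  have hδ0 : 0 < δ := by positivity
  have hxσ : 0 < x ^ (-s.re) := Real.rpow_pos_of_pos hx _
  have hint := integrableOn_wave_Ioi α (ν : ℤ) (w := s + 1) (by simpa using hσ) hx
  have hsplit : ∫ u in Ioi x, wave α (ν : ℤ) (s + 1) u =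
      (∫ u in x..(x + δ), wave α (ν : ℤ) (s + 1) u) +
        ∫ u in Ioi (x + δ), wave α (ν : ℤ) (s + 1) u := by
    rw [intervalIntegral.integral_interval_add_Ioi hint
      (hint.mono_set (Ioi_subset_Ioi (by linarith)))]
  have h1 : ‖∫ u in x..(x + δ), wave α (ν : ℤ) (s + 1) u‖ ≤ x ^ (-s.re) / √t := by
    have := intervalIntegral.norm_integral_le_of_norm_le_const (a := x) (b := x + δ)
      (f := wave α (ν : ℤ) (s + 1)) (C := x ^ (-s.re) / x) (fun u hu => by
        rw [uIoc_of_le (by linarith)] at hu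
        have hu0 : 0 < u := hx.trans hu.1
        rw [norm_wave _ _ _ hu0]
        calc u ^ (-(s + 1).re) ≤ x ^ (-(s + 1).re) :=
              Real.rpow_le_rpow_of_nonpos hx hu.1.le (by simp; linarith)
          _ = x ^ (-s.re) / x := by
              rw [Complex.add_re, Complex.one_re, neg_add, ← sub_eq_add_neg,
                Real.rpow_sub_one hx.ne'])
    refine this.trans (le_of_eq ?_)
    rw [add_sub_cancel_left, abs_of_pos hδ0, hδ]
    field_simp
  have h2 : ‖∫ u in Ioi (x + δ), wave α (ν : ℤ) (s + 1) u‖ ≤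
      2 * (x ^ (-s.re) / (2 * π * ν * δ)) := by
    refine (norm_integral_wave_upper_le hσ ht.le (by linarith) ?_).trans ?_
    · refine hν.trans_le ?_
      gcongr
      linarith
    · have : 2 * π * ν * δ ≤ 2 * π * ν * (x + δ) - s.im := by
        rw [mul_add]; linarith
      have h3 : (x + δ) ^ (-s.re) ≤ x ^ (-s.re) :=
        Real.rpow_le_rpow_of_nonpos hx (by linarith) (by linarith)
      gcongr
  have hpn : 0 < 2 * π * ν := by positivity
  have hinv : 1 / (2 * π * ν) ≤ x / t := by
    rw [div_le_div_iff₀ hpn ht]; linarith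
  have hs := norm_le_one_add_im hσ hσ1 ht.le
  rw [norm_upperTerm_eq, hsplit]
  have hone : (1 + t) / t ≤ 1 + 1 / c ^ 2 := by
    rw [add_div, div_self ht.ne', add_comm]
    gcongr
  calc ‖s‖ / (2 * π * ν) * ‖(∫ u in x..(x + δ), wave α (ν : ℤ) (s + 1) u) +
        ∫ u in Ioi (x + δ), wave α (ν : ℤ) (s + 1) u‖
      ≤ (1 + t) * (1 / (2 * π * ν)) *
        (x ^ (-s.re) / √t + 2 * (x ^ (-s.re) * (1 / (2 * π * ν)) / δ)) := by
        rw [div_eq_mul_one_div ‖s‖]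
        gcongr
        refine (norm_add_le _ _).trans (add_le_add h1 (h2.trans (le_of_eq ?_)))
        field_simp
    _ ≤ (1 + t) * (x / t) * (x ^ (-s.re) / √t + 2 * (x ^ (-s.re) * (x / t) / δ)) := by
        gcongr
    _ = (1 + t) / t * (3 * (x * x ^ (-s.re) / √t)) := by
        rw [hδ]
        have : x ^ (-s.re) * (x / t) / (x / √t) = x ^ (-s.re) / √t := by
          rw [show x / t = x / √t / √t by rw [div_div, hrr]]
          field_simp
        rw [this]; ring
    _ ≤ (1 + 1 / c ^ 2) * (3 * (x * x ^ (-s.re) / √t)) := by gcongr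
    _ = 3 * (1 + 1 / c ^ 2) * (x ^ (1 - s.re) / √t) := by
        rw [sub_eq_add_neg 1, Real.rpow_add hx, Real.rpow_one]; ring

/-- A lower term whose stationary point `t / (2πν)` is at least `x`, however close. The piece
`[x - c x / √t, x]` is estimated trivially; the hypothesis on `c` keeps it inside `[x / 2, x]`. -/
lemma norm_lowerTerm_le_near (hσ : 0 < s.re) (hσ1 : s.re < 1) (hc : 0 < c) (hx : 0 < x)
    (hct : 4 * c ^ 2 ≤ s.im) (hν : 2 * π * ν * x ≤ s.im) :
    ‖lowerTerm s α x ν‖ ≤ (2 / c + 2 * c) * (x ^ (1 - s.re) / √s.im) := by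
  set t := s.im with ht_def
  have ht : 0 < t := (by positivity : 0 < 4 * c ^ 2).trans_le hct
  have hr : 0 < √t := Real.sqrt_pos.2 ht
  have hrr : √t * √t = t := Real.mul_self_sqrt ht.le
  have hcr : 2 * c ≤ √t := Real.le_sqrt_of_sq_le (by linarith)
  set δ := c * x / √t with hδ
  have hδ0 : 0 < δ := by positivity
  have hδx : δ ≤ x / 2 := by
    rw [hδ, div_le_div_iff₀ hr two_pos]; nlinarith
  have hxσ : 0 < x ^ (-s.re) := Real.rpow_pos_of_pos hx _
  -- `2πν ≤ t / x`, hence the gap at `x - δ` is at least `t δ / x`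
  have hgap : c * √t ≤ t - 2 * π * ν * (x - δ) := by
    have h1 : 2 * π * ν * (x - δ) ≤ t / x * (x - δ) := by
      refine mul_le_mul_of_nonneg_right ?_ (by linarith)
      rwa [le_div_iff₀ hx]
    have h2 : t / x * (x - δ) = t - c * √t := by
      rw [hδ, mul_sub, div_mul_cancel₀ _ hx.ne']
      congr 1
      rw [show t / x * (c * x / √t) = c * (t / √t) by field_simp, Real.div_sqrt]
    linarith
  have hsplit : lowerTerm s α x ν =
      (∫ u in (0 : ℝ)..(x - δ), wave α (ν : ℤ) s u) + ∫ u in (x - δ)..x, wave α (ν : ℤ) s u := by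
    rw [lowerTerm, intervalIntegral.integral_add_adjacent_intervals] <;>
    exact intervalIntegrable_wave _ _ hσ1 _ _
  have h1 : ‖∫ u in (0 : ℝ)..(x - δ), wave α (ν : ℤ) s u‖ ≤
      2 * (x ^ (1 - s.re) / (c * √t)) := by
    have hcp : 0 < c * √t := by positivity
    refine (norm_integral_wave_lower_le hσ hσ1 (by linarith) (by linarith)).trans ?_
    have : (x - δ) ^ (1 - s.re) ≤ x ^ (1 - s.re) :=
      Real.rpow_le_rpow (by linarith) (by linarith) (by linarith)
    gcongr
  have h2 : ‖∫ u in (x - δ)..x, wave α (ν : ℤ) s u‖ ≤ 2 * x ^ (-s.re) * δ := by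
    have := intervalIntegral.norm_integral_le_of_norm_le_const (a := x - δ) (b := x)
      (f := wave α (ν : ℤ) s) (C := 2 * x ^ (-s.re)) (fun u hu => by
        rw [uIoc_of_le (by linarith)] at hu
        have hu2 : x / 2 ≤ u := by linarith [hu.1]
        rw [norm_wave _ _ _ (by linarith)]
        calc u ^ (-s.re) ≤ (x / 2) ^ (-s.re) :=
              Real.rpow_le_rpow_of_nonpos (by linarith) hu2 (by linarith)
          _ = 2 ^ s.re * x ^ (-s.re) := by
              rw [Real.div_rpow hx.le zero_le_two, Real.rpow_neg zero_le_two, div_inv_eq_mul,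
                mul_comm]
          _ ≤ 2 * x ^ (-s.re) := by
              gcongr
              calc (2 : ℝ) ^ s.re ≤ 2 ^ (1 : ℝ) :=
                    Real.rpow_le_rpow_of_exponent_le one_le_two hσ1.le
                _ = 2 := Real.rpow_one 2)
    rwa [sub_sub_cancel, abs_of_pos hδ0] at this
  rw [hsplit]
  calc _ ≤ 2 * (x ^ (1 - s.re) / (c * √t)) + 2 * x ^ (-s.re) * δ :=
        (norm_add_le _ _).trans (add_le_add h1 h2)
    _ = (2 / c + 2 * c) * (x ^ (1 - s.re) / √t) := by
        rw [hδ, sub_eq_add_neg 1, Real.rpow_add hx, Real.rpow_one]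
        field_simp

lemma norm_sum_le_of_card_le_one {F : Finset ℕ} {f : ℕ → ℂ} {B : ℝ} (hB : 0 ≤ B)
    (hF : F.card ≤ 1) (hf : ∀ ν ∈ F, ‖f ν‖ ≤ B) : ‖∑ ν ∈ F, f ν‖ ≤ B := by
  have h := (norm_sum_le F f).trans (Finset.sum_le_card_nsmul F _ B hf)
  rw [nsmul_eq_mul] at h
  have : (F.card : ℝ) ≤ 1 := by exact_mod_cast hF
  nlinarith

lemma norm_K2_le {η : ℝ} (hη1 : η < 1) (hσ : 0 < s.re) (hσ1 : s.re < 1)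
    (hc : 0 < c) (hx : c ≤ x) (hy : c ≤ y) (hyt : s.im = 2 * π * x * y) :
    ‖K2 s α x y η‖ ≤
      (3 * (1 + 1 / c ^ 2) + (2 / c + 2 * c)) * (x ^ (1 - s.re) / √s.im) := by
  have hx0 : 0 < x := hc.trans_le hx
  have hct : 4 * c ^ 2 ≤ s.im := by
    rw [hyt]
    have h1 : c * c ≤ x * y := mul_le_mul hx hy hc.le hx0.le
    nlinarith [Real.pi_gt_three, mul_pos hc hc]
  have hB : 0 ≤ x ^ (1 - s.re) / √s.im := by positivity
  rw [K2, add_mul]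
  -- an interval of length `η < 1` contains at most one integer
  refine (norm_sub_le _ _).trans (add_le_add ?_ ?_)
  · refine norm_sum_le_of_card_le_one (by positivity) (Finset.card_le_one.2 ?_) ?_
    · intro a ha b hb
      simp only [Finset.mem_filter] at ha hb
      have h1 : (a : ℝ) < b + 1 := by linarith
      have h2 : (b : ℝ) < a + 1 := by linarith
      have h3 : a < b + 1 := by exact_mod_cast h1
      have h4 : b < a + 1 := by exact_mod_cast h2
      omega
    · intro ν hν
      simp only [Finset.mem_filter] at hν
      refine norm_upperTerm_le_near hσ hσ1 hc hx0 (by nlinarith) ?_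
      rw [hyt, mul_right_comm]
      gcongr
      exact hν.2.1
  · refine norm_sum_le_of_card_le_one (by positivity) (Finset.card_le_one.2 ?_) ?_
    · intro a ha b hb
      simp only [Finset.mem_filter, Finset.mem_Icc, Nat.le_floor_iff (hc.le.trans hy)] at ha hb
      have h1 : (a : ℝ) < b + 1 := by linarith
      have h2 : (b : ℝ) < a + 1 := by linarith
      have h3 : a < b + 1 := by exact_mod_cast h1
      have h4 : b < a + 1 := by exact_mod_cast h2
      omega
    · intro ν hν
      simp only [Finset.mem_filter, Finset.mem_Icc, Nat.le_floor_iff (hc.le.trans hy)] at hν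
      refine norm_lowerTerm_le_near hσ hσ1 hc hx0 hct ?_
      rw [hyt, mul_right_comm]
      gcongr
      exact hν.1.2

end SecondDerivative

/-! ### Frequencies away from the stationary one -/

/-- With `f k = log ((k + 1 + y) / (k + 1))`, the term of index `k + 1` is at most `f k - f (k + 1)`,
by `1 - 1 / z ≤ log z`. -/
lemma sum_range_le_one_add_log {y : ℝ} (hy : 0 < y) (n : ℕ) :
    ∑ k ∈ Finset.range n, y / (((k : ℝ) + 1) * (y + k)) ≤ 1 + Real.log (1 + y) := by
  have key : ∀ n : ℕ, ∑ k ∈ Finset.range (n + 1), y / (((k : ℝ) + 1) * (y + k)) ≤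
      1 + Real.log (1 + y) - Real.log (((n : ℝ) + 1 + y) / (n + 1)) := by
    intro n
    induction n with
    | zero =>
      simp [div_self hy.ne']
    | succ n ih =>
      rw [Finset.sum_range_succ]
      have hn : (0 : ℝ) ≤ n := n.cast_nonneg
      have h1 : (0 : ℝ) < ((n : ℝ) + 1 + y) / (n + 1) := by positivity
      have h2 : (0 : ℝ) < ((n : ℝ) + 2 + y) / (n + 2) := by positivity
      have h3 := Real.one_sub_inv_le_log_of_pos (div_pos h1 h2)
      rw [Real.log_div h1.ne' h2.ne'] at h3
      have h4 : 1 - (((n : ℝ) + 1 + y) / (n + 1) / (((n : ℝ) + 2 + y) / (n + 2)))⁻¹ =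
          y / (((n + 1 : ℕ) + 1) * (y + (n + 1 : ℕ))) := by
        push_cast
        field_simp
        ring
      rw [h4] at h3
      have h5 : (((n + 1 : ℕ) : ℝ) + 1 + y) / ((n + 1 : ℕ) + 1) =
          ((n : ℝ) + 2 + y) / (n + 2) := by
        push_cast; ring
      rw [h5]
      linarith
  have hlog : 0 ≤ Real.log (1 + y) := Real.log_nonneg (by linarith)
  rcases n with _ | n
  · simp; linarith
  · refine (key n).trans (sub_le_self _ (Real.log_nonneg ?_))
    rw [le_div_iff₀ (by positivity)]
    linarith

/-- Comparison of a series over an arbitrary set of integers `ν ≥ m` with one indexed by `ν - m`. -/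
lemma norm_tsum_subtype_le {p : ℕ → Prop} {f : ℕ → ℂ} {m : ℕ} {g : ℕ → ℝ} {B : ℝ}
    (hp : ∀ ν, p ν → m ≤ ν) (hg : ∀ k, 0 ≤ g k) (hf : ∀ k, p (m + k) → ‖f (m + k)‖ ≤ g k)
    (hB : ∀ n, ∑ k ∈ Finset.range n, g k ≤ B) : ‖∑' ν : {ν : ℕ // p ν}, f ν‖ ≤ B := by
  have hs := summable_of_sum_range_le hg hB
  let i : {ν : ℕ // p ν} → ℕ := fun ν => ν - m
  have hi : Function.Injective i := by
    rintro ⟨a, ha⟩ ⟨b, hb⟩ hab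
    have h1 := hp a ha
    have h2 := hp b hb
    simp only [i] at hab
    simp only [Subtype.mk.injEq]
    omega
  have hsi : Summable (g ∘ i) := hs.comp_injective hi
  refine (tsum_of_norm_bounded hsi.hasSum fun ν => ?_).trans ?_
  · have h1 : m + (ν.1 - m) = ν.1 := Nat.add_sub_cancel' (hp ν.1 ν.2)
    have := hf (ν.1 - m) (by rw [h1]; exact ν.2)
    rwa [h1] at this
  · exact (hsi.tsum_le_tsum_of_inj i hi (fun k _ => hg k) (fun _ => le_rfl) hs).trans
      (Real.tsum_le_of_sum_range_le hg hB)

lemma sum_Icc_inv_le (N : ℕ) : ∑ ν ∈ Finset.Icc 1 N, ((ν : ℝ))⁻¹ ≤ 1 + Real.log N := by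
  have h := harmonic_le_one_add_log N
  rw [harmonic_eq_sum_Icc] at h
  push_cast at h
  exact h

lemma log_floor_le {y : ℝ} (hy : 0 ≤ y) : Real.log (⌊y⌋₊ : ℝ) ≤ Real.log (1 + y) := by
  have h2 := Nat.floor_le hy
  -- for `⌊y⌋ = 0` the left-hand side is the junk value `Real.log 0 = 0`
  rcases Nat.eq_zero_or_pos ⌊y⌋₊ with h | h
  · rw [h, Nat.cast_zero, Real.log_zero]
    exact Real.log_nonneg (by linarith)
  · exact Real.log_le_log (by exact_mod_cast h) (by linarith)

lemma abs_psi_le (u : ℝ) : |psi u| ≤ 1 / 2 := by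
  rw [psi, abs_le]
  constructor <;> linarith [Int.floor_le u, Int.lt_floor_add_one u]

section FirstDerivative

variable {s : ℂ} {α x y c η : ℝ}

lemma norm_boundaryTerm_le (hx : 0 < x) (hy : 0 ≤ y) :
    ‖boundaryTerm s α x ⌊y⌋₊‖ ≤ x ^ (-s.re) * (2 * (1 + Real.log (1 + y))) := by
  rw [boundaryTerm, norm_mul, Complex.norm_cpow_eq_rpow_re_of_pos hx, Complex.neg_re]
  have hlog : 0 ≤ Real.log (1 + y) := Real.log_nonneg (by linarith)
  refine mul_le_mul_of_nonneg_left ?_ (Real.rpow_nonneg hx.le _)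
  have h1 : ‖((psi (x - α) : ℝ) : ℂ)‖ ≤ 1 / 2 := by
    rw [Complex.norm_real]; exact abs_psi_le _
  have h2 : ‖∑ ν ∈ Finset.Icc 1 ⌊y⌋₊,
      Complex.exp (2 * (π : ℂ) * Complex.I * (ν : ℂ) * ((x : ℂ) - (α : ℂ))) /
        (2 * (π : ℂ) * Complex.I * (ν : ℂ))‖ ≤ 1 + Real.log (1 + y) := by
    calc _ ≤ ∑ ν ∈ Finset.Icc 1 ⌊y⌋₊, ((ν : ℝ))⁻¹ := by
          refine norm_sum_le_of_le _ fun ν hν => ?_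
          have hν1 : (1 : ℝ) ≤ ν := by exact_mod_cast (Finset.mem_Icc.1 hν).1
          have he := norm_exp_phase α (ν : ℤ) x
          simp only [Int.cast_natCast] at he
          rw [norm_div, he]
          simp only [norm_mul, Complex.norm_I, Complex.norm_real, Complex.norm_natCast,
            Complex.norm_ofNat, mul_one, Real.norm_eq_abs, abs_of_pos Real.pi_pos]
          rw [one_div]
          refine inv_anti₀ (by linarith) ?_
          nlinarith [Real.pi_gt_three]
      _ ≤ 1 + Real.log (⌊y⌋₊ : ℝ) := sum_Icc_inv_le _
      _ ≤ _ := by linarith [log_floor_le hy]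
  refine (norm_add_le _ _).trans ?_
  linarith

/-- The factor `|s|` of the upper terms costs at most a constant times `xy`. -/
lemma norm_mul_inv_le (hσ : 0 < s.re) (hσ1 : s.re < 1) (hc : 0 < c) (hx : c ≤ x) (hy : c ≤ y)
    (hyt : s.im = 2 * π * x * y) : ‖s‖ / (2 * π * (π * x)) ≤ (1 + 1 / c ^ 2) * y := by
  have hx0 : 0 < x := hc.trans_le hx
  have hy0 : 0 < y := hc.trans_le hy
  have ht : 0 ≤ s.im := by rw [hyt]; positivity
  have h1 := norm_le_one_add_im hσ hσ1 ht
  have hpi := Real.pi_gt_three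
  have hcx : c ^ 2 ≤ x * y := by
    rw [sq]; exact mul_le_mul hx hy hc.le hx0.le
  rw [div_le_iff₀ (by positivity)]
  refine h1.trans ?_
  rw [hyt]
  have h2 : 1 ≤ 1 / c ^ 2 * (x * y) := by
    rw [div_mul_eq_mul_div, one_mul, le_div_iff₀ (by positivity)]; linarith
  have hpp : 1 ≤ 2 * π * π := by nlinarith
  have h3 : (1 : ℝ) ≤ 1 / c ^ 2 * (x * y) * (2 * π * π) := one_le_mul_of_one_le_of_one_le h2 hpp
  have h4 : 2 * π * x * y ≤ x * y * (2 * π * π) := by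
    have : 0 < x * y := by positivity
    nlinarith [mul_pos this Real.pi_pos]
  linarith

lemma norm_tsum_upperTerm_le (hη : 0 < η) (hη1 : η < 1) (hσ : 0 < s.re) (hσ1 : s.re < 1)
    (hc : 0 < c) (hx : c ≤ x) (hy : c ≤ y) (hyt : s.im = 2 * π * x * y) :
    ‖∑' ν : {ν : ℕ // 1 ≤ ν ∧ y + η ≤ (ν : ℝ)}, upperTerm s α x ν‖ ≤
      x ^ (-s.re) * ((1 + 1 / c ^ 2) * (1 / η) * (1 + Real.log (1 + y))) := by
  have hx0 : 0 < x := hc.trans_le hx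
  have hy0 : 0 < y := hc.trans_le hy
  have ht : 0 ≤ s.im := by rw [hyt]; positivity
  have hxσ : 0 < x ^ (-s.re) := Real.rpow_pos_of_pos hx0 _
  have hs := norm_mul_inv_le hσ hσ1 hc hx hy hyt
  refine norm_tsum_subtype_le (p := fun ν : ℕ => 1 ≤ ν ∧ y + η ≤ (ν : ℝ)) (m := ⌈y + η⌉₊)
    (g := fun k => x ^ (-s.re) * ((1 + 1 / c ^ 2) * (1 / η) * (y / (((k : ℝ) + 1) * (y + k)))))
    (fun ν hν => Nat.ceil_le.2 hν.2) (fun k => by positivity) (fun k hk => ?_) (fun n => ?_)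
  · set m := ⌈y + η⌉₊
    have hm : y + η ≤ m := Nat.le_ceil _
    have hk0 : (0 : ℝ) ≤ k := k.cast_nonneg
    have hmk : ((m + k : ℕ) : ℝ) = m + k := by push_cast; ring
    have h1 : y + k ≤ (m + k : ℕ) := by rw [hmk]; linarith
    -- `ν - y ≥ k + η ≥ η (k + 1)` for `ν = m + k`
    have h2 : η * (k + 1) ≤ (m + k : ℕ) - y := by rw [hmk]; nlinarith
    have hpos : 0 < ((m + k : ℕ) : ℝ) - y := lt_of_lt_of_le (by positivity) h2
    have hν0 : (0 : ℝ) < (m + k : ℕ) := by linarith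
    generalize hN : m + k = N at *
    have hlt : s.im < 2 * π * N * x := by
      rw [hyt, mul_right_comm]; gcongr; linarith
    rw [norm_upperTerm_eq]
    calc ‖s‖ / (2 * π * N) * ‖∫ u in Ioi x, wave α (N : ℤ) (s + 1) u‖
        ≤ ‖s‖ / (2 * π * N) * (2 * (x ^ (-s.re) / (2 * π * N * x - s.im))) := by
          gcongr
          exact norm_integral_wave_upper_le hσ ht hx0 hlt
      _ = x ^ (-s.re) * (‖s‖ / (2 * π * (π * x)) * (1 / (N * (N - y)))) := by
          have : 2 * π * N * x - s.im = 2 * π * x * (N - y) := by rw [hyt]; ring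
          rw [this]
          field_simp
      _ ≤ x ^ (-s.re) * ((1 + 1 / c ^ 2) * y * (1 / ((y + k) * (η * (k + 1))))) := by
          gcongr
      _ = _ := by field_simp
  · rw [← Finset.mul_sum, ← Finset.mul_sum]
    gcongr
    exact sum_range_le_one_add_log hy0 n

lemma norm_tsum_upperTermNeg_le (hσ : 0 < s.re) (hσ1 : s.re < 1)
    (hc : 0 < c) (hx : c ≤ x) (hy : c ≤ y) (hyt : s.im = 2 * π * x * y) :
    ‖∑' ν : {ν : ℕ // 1 ≤ ν}, upperTermNeg s α x ν‖ ≤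
      x ^ (-s.re) * ((1 + 1 / c ^ 2) * (1 + Real.log (1 + y))) := by
  have hx0 : 0 < x := hc.trans_le hx
  have hy0 : 0 < y := hc.trans_le hy
  have ht : 0 ≤ s.im := by rw [hyt]; positivity
  have hxσ : 0 < x ^ (-s.re) := Real.rpow_pos_of_pos hx0 _
  have hs := norm_mul_inv_le hσ hσ1 hc hx hy hyt
  refine norm_tsum_subtype_le (p := fun ν : ℕ => 1 ≤ ν) (m := 1)
    (g := fun k => x ^ (-s.re) * ((1 + 1 / c ^ 2) * (y / (((k : ℝ) + 1) * (y + k)))))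
    (fun ν hν => hν) (fun k => by positivity) (fun k hk => ?_) (fun n => ?_)
  · have hk0 : (0 : ℝ) ≤ k := k.cast_nonneg
    have hmk : ((1 + k : ℕ) : ℝ) = k + 1 := by push_cast; ring
    rw [norm_upperTermNeg_eq]
    calc ‖s‖ / (2 * π * (1 + k : ℕ)) * ‖∫ u in Ioi x, wave α (-((1 + k : ℕ) : ℤ)) (s + 1) u‖
        ≤ ‖s‖ / (2 * π * (1 + k : ℕ)) *
            (2 * (x ^ (-s.re) / (2 * π * (1 + k : ℕ) * x + s.im))) := by
          gcongr
          exact norm_integral_wave_upper_neg_le hσ ht hx0 hk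
      _ = x ^ (-s.re) * (‖s‖ / (2 * π * (π * x)) * (1 / ((k + 1) * (k + 1 + y)))) := by
          rw [hmk]
          have : 2 * π * (k + 1) * x + s.im = 2 * π * x * (k + 1 + y) := by rw [hyt]; ring
          rw [this]
          field_simp
      _ ≤ x ^ (-s.re) * ((1 + 1 / c ^ 2) * y * (1 / ((k + 1) * (y + k)))) := by
          gcongr ?_ * (?_ * (1 / (_ * ?_)))
          linarith
      _ = _ := by ring
  · rw [← Finset.mul_sum, ← Finset.mul_sum]
    gcongr
    exact sum_range_le_one_add_log hy0 n

lemma norm_sum_lowerTerm_le (hη : 0 < η) (hη1 : η < 1) (hσ : 0 < s.re) (hσ1 : s.re < 1)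
    (hx : 0 < x) (hy : 0 < y) (hyt : s.im = 2 * π * x * y) :
    ‖∑ ν ∈ Finset.Icc 1 ⌊y⌋₊ with ((ν : ℕ) : ℝ) ≤ y - η, lowerTerm s α x ν‖ ≤
      x ^ (-s.re) * (2 / η * (1 + Real.log (1 + y))) := by
  have hxσ : 0 < x ^ (-s.re) := Real.rpow_pos_of_pos hx _
  set N := ⌊y⌋₊ with hN
  have hNy : (N : ℝ) ≤ y := Nat.floor_le hy.le
  calc _ ≤ ∑ ν ∈ Finset.Icc 1 N with ((ν : ℕ) : ℝ) ≤ y - η,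
        x ^ (-s.re) * (2 / η * (((N + 1 - ν : ℕ) : ℝ))⁻¹) := by
        refine norm_sum_le_of_le _ fun ν hν => ?_
        simp only [Finset.mem_filter, Finset.mem_Icc] at hν
        obtain ⟨⟨h1, h2⟩, h3⟩ := hν
        have hlt : 2 * π * ν * x < s.im := by
          rw [hyt, mul_right_comm]; gcongr; linarith
        refine (norm_integral_wave_lower_le hσ hσ1 hx hlt).trans ?_
        have hsub : ((N + 1 - ν : ℕ) : ℝ) = N - ν + 1 := by
          rw [Nat.cast_sub (by omega)]; push_cast; ring
        have h2' : (ν : ℝ) ≤ N := by exact_mod_cast h2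
        -- `y - ν` is at least `η` and at least the integer `N - ν`
        have hgap : η / 2 * (N - ν + 1) ≤ y - ν := by
          rcases h2.eq_or_lt with h | h
          · rw [h] at h3 ⊢; linarith
          · have : (ν : ℝ) + 1 ≤ N := by exact_mod_cast h
            nlinarith
        have hn1 : (0 : ℝ) < N - ν + 1 := by linarith
        rw [hsub]
        calc 2 * (x ^ (1 - s.re) / (s.im - 2 * π * ν * x))
            = x ^ (-s.re) * (1 / (π * (y - ν))) := by
              have : s.im - 2 * π * ν * x = 2 * π * x * (y - ν) := by rw [hyt]; ring
              rw [this, sub_eq_add_neg 1, Real.rpow_add hx, Real.rpow_one]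
              field_simp
          _ ≤ x ^ (-s.re) * (1 / (1 * (η / 2 * (N - ν + 1)))) := by
              gcongr
              linarith [Real.pi_gt_three]
          _ = _ := by field_simp
    _ ≤ ∑ ν ∈ Finset.Icc 1 N, x ^ (-s.re) * (2 / η * (((N + 1 - ν : ℕ) : ℝ))⁻¹) :=
        Finset.sum_le_sum_of_subset_of_nonneg (Finset.filter_subset _ _)
          fun _ _ _ => by positivity
    _ = x ^ (-s.re) * (2 / η * ∑ ν ∈ Finset.Icc 1 N, ((ν : ℝ))⁻¹) := by
        rw [← Finset.mul_sum, ← Finset.mul_sum]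
        congr 2
        refine Finset.sum_nbij' (fun ν => N + 1 - ν) (fun ν => N + 1 - ν) ?_ ?_ ?_ ?_ ?_
        · intro a ha; simp only [Finset.mem_Icc] at ha ⊢; omega
        · intro a ha; simp only [Finset.mem_Icc] at ha ⊢; omega
        · intro a ha; simp only [Finset.mem_Icc] at ha ⊢; omega
        · intro a ha; simp only [Finset.mem_Icc] at ha ⊢; omega
        · intro a ha; rfl
    _ ≤ _ := by
        gcongr
        exact (sum_Icc_inv_le N).trans (by linarith [log_floor_le hy.le])

lemma one_add_log_le {t : ℝ} (hc : 0 < c) (hx : c ≤ x) (hy : 0 ≤ y) (hyt : t = 2 * π * x * y) :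
    1 + Real.log (1 + y) ≤ (2 * (1 + 1 / c) + 3) * Real.log (t + 2) := by
  have hx0 : 0 < x := hc.trans_le hx
  have ht : 0 ≤ t := by rw [hyt]; positivity
  have hM : 0 < 1 + 1 / c := by positivity
  have hcy : c * y ≤ t := by
    rw [hyt]
    have : c * y ≤ x * y := by gcongr
    nlinarith [Real.pi_gt_three, mul_nonneg hx0.le hy]
  have hy' : y ≤ 1 / c * t := by
    rw [div_mul_eq_mul_div, one_mul, le_div_iff₀ hc]; linarith
  have h1 : 1 + y ≤ (1 + 1 / c) * (t + 2) := by
    have : 0 < 1 / c := by positivity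
    nlinarith
  have h2 := Real.log_le_log (by linarith) h1
  rw [Real.log_mul hM.ne' (by linarith)] at h2
  have h3 := Real.log_le_sub_one_of_pos hM
  have h4 : 1 / 2 ≤ Real.log (t + 2) := by
    have := Real.log_le_log two_pos (by linarith : (2 : ℝ) ≤ t + 2)
    linarith [Real.log_two_gt_d9]
  nlinarith

lemma norm_K1_le (hη : 0 < η) (hη1 : η < 1) (hσ : 0 < s.re) (hσ1 : s.re < 1)
    (hc : 0 < c) (hx : c ≤ x) (hy : c ≤ y) (hyt : s.im = 2 * π * x * y) :
    ‖K1 s α x y η‖ ≤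
      ((2 + (1 + 1 / c ^ 2) * (1 / η) + 2 / η + (1 + 1 / c ^ 2)) * (2 * (1 + 1 / c) + 3)) *
        (x ^ (-s.re) * Real.log (s.im + 2)) := by
  have hx0 : 0 < x := hc.trans_le hx
  have hy0 : 0 < y := hc.trans_le hy
  have h1 := norm_boundaryTerm_le (s := s) (α := α) hx0 hy0.le
  have h2 := norm_tsum_upperTerm_le (α := α) hη hη1 hσ hσ1 hc hx hy hyt
  have h3 := norm_sum_lowerTerm_le (α := α) hη hη1 hσ hσ1 hx0 hy0 hyt
  have h4 := norm_tsum_upperTermNeg_le (α := α) hσ hσ1 hc hx hy hyt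
  have h5 := one_add_log_le hc hx hy0.le hyt
  rw [K1]
  calc _ ≤ x ^ (-s.re) * (2 * (1 + Real.log (1 + y))) +
        x ^ (-s.re) * ((1 + 1 / c ^ 2) * (1 / η) * (1 + Real.log (1 + y))) +
        x ^ (-s.re) * (2 / η * (1 + Real.log (1 + y))) +
        x ^ (-s.re) * ((1 + 1 / c ^ 2) * (1 + Real.log (1 + y))) :=
        norm_sub_le_of_le (norm_sub_le_of_le (norm_add_le_of_le h1 h2) h3) h4
    _ = (2 + (1 + 1 / c ^ 2) * (1 / η) + 2 / η + (1 + 1 / c ^ 2)) *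
        (x ^ (-s.re) * (1 + Real.log (1 + y))) := by ring
    _ ≤ (2 + (1 + 1 / c ^ 2) * (1 / η) + 2 / η + (1 + 1 / c ^ 2)) *
        (x ^ (-s.re) * ((2 * (1 + 1 / c) + 3) * Real.log (s.im + 2))) := by gcongr
    _ = _ := by ring

end FirstDerivative

/-- For integral `y` no integer other than `y` lies within `1 / 2` of it, so that the special form
is the case `η = 1 / 2` of the general one. -/
lemma K1Int_eq (s : ℂ) (α x : ℝ) (ν₀ : ℕ) :
    K1Int s α x ν₀ = K1 s α x ν₀ (1 / 2) := by
  have h1 : (∑' ν : {ν : ℕ // ν₀ + 1 ≤ ν}, upperTerm s α x ν) =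
      ∑' ν : {ν : ℕ // 1 ≤ ν ∧ (ν₀ : ℝ) + 1 / 2 ≤ (ν : ℝ)}, upperTerm s α x ν := by
    have hcongr : ∀ p q : ℕ → Prop, p = q → (∑' ν : {ν : ℕ // p ν}, upperTerm s α x ν) =
        ∑' ν : {ν : ℕ // q ν}, upperTerm s α x ν := by
      rintro p _ rfl; rfl
    refine hcongr (fun ν => ν₀ + 1 ≤ ν) (fun ν => 1 ≤ ν ∧ (ν₀ : ℝ) + 1 / 2 ≤ (ν : ℝ))
      (funext fun ν => propext ⟨fun h => ?_, fun h => ?_⟩)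
    · have : (ν₀ : ℝ) + 1 ≤ ν := by exact_mod_cast h
      exact ⟨by omega, by linarith⟩
    · have : (ν₀ : ℝ) < ν := by linarith [h.2]
      exact_mod_cast this
  have h2 : ∑ ν ∈ Finset.Icc 1 (ν₀ - 1), lowerTerm s α x ν =
      ∑ ν ∈ Finset.Icc 1 ν₀ with ((ν : ℕ) : ℝ) ≤ ν₀ - 1 / 2, lowerTerm s α x ν := by
    congr 1
    ext ν
    simp only [Finset.mem_filter, Finset.mem_Icc]
    constructor
    · rintro ⟨h1, h2⟩
      have : ν + 1 ≤ ν₀ := by omega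
      have : (ν : ℝ) + 1 ≤ ν₀ := by exact_mod_cast this
      exact ⟨⟨h1, by omega⟩, by linarith⟩
    · rintro ⟨⟨h1, h2⟩, h3⟩
      have : (ν : ℝ) < ν₀ := by linarith
      have : ν < ν₀ := by exact_mod_cast this
      omega
  rw [K1Int, K1, h1, h2, Nat.floor_natCast]

lemma K2Int_eq (s : ℂ) (α x : ℝ) {ν₀ : ℕ} (hν₀ : 1 ≤ ν₀) :
    K2Int s α x ν₀ = K2 s α x ν₀ (1 / 2) := by
  have h1 : (Finset.Icc 1 ⌈(ν₀ : ℝ) + 1 / 2⌉₊).filter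
      (fun ν : ℕ => (ν₀ : ℝ) < ν ∧ (ν : ℝ) < ν₀ + 1 / 2) = ∅ := by
    refine Finset.filter_eq_empty_iff.2 fun ν _ ⟨h1, h2⟩ => ?_
    have h1' : ν₀ < ν := by exact_mod_cast h1
    have : (ν₀ : ℝ) + 1 ≤ ν := by exact_mod_cast h1'
    linarith
  have h2 : (Finset.Icc 1 ν₀).filter (fun ν : ℕ => (ν₀ : ℝ) - 1 / 2 < ν) = {ν₀} := by
    ext ν
    simp only [Finset.mem_filter, Finset.mem_Icc, Finset.mem_singleton]
    constructor
    · rintro ⟨⟨h1, h2⟩, h3⟩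
      by_contra hne
      have : ν + 1 ≤ ν₀ := by omega
      have : (ν : ℝ) + 1 ≤ ν₀ := by exact_mod_cast this
      linarith
    · rintro rfl
      exact ⟨⟨hν₀, le_rfl⟩, by linarith⟩
  rw [K2Int, K2, Nat.floor_natCast, h1, h2, Finset.sum_empty, Finset.sum_singleton, zero_sub]

/-! ### The Gamma integral on the imaginary axis -/

section RotatedGamma

lemma norm_cpow_mul_exp (a r : ℂ) {u : ℝ} (hu : 0 < u) :
    ‖(u : ℂ) ^ a * Complex.exp (-(r * u))‖ = u ^ a.re * Real.exp (-(r.re * u)) := by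
  rw [norm_mul, Complex.norm_cpow_eq_rpow_re_of_pos hu, Complex.norm_exp]
  simp

lemma continuousOn_cpow_mul_exp (a r : ℂ) :
    ContinuousOn (fun u : ℝ => (u : ℂ) ^ a * Complex.exp (-(r * u))) (Ioi 0) := by
  intro u hu
  refine ContinuousAt.continuousWithinAt (ContinuousAt.mul ?_ (by fun_prop))
  exact Complex.continuousAt_ofReal_cpow_const _ _ (Or.inr (ne_of_gt hu))

lemma aestronglyMeasurable_cpow_mul_exp (a r : ℂ) {b : ℝ} (hb : 0 ≤ b) :
    AEStronglyMeasurable (fun u : ℝ => (u : ℂ) ^ a * Complex.exp (-(r * u)))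
      (volume.restrict (Ioi b)) :=
  ((continuousOn_cpow_mul_exp a r).mono (Ioi_subset_Ioi hb)).aestronglyMeasurable measurableSet_Ioi

lemma integrableOn_rpow_mul_exp_neg {p ε : ℝ} (hp : -1 < p) (hε : 0 < ε) :
    IntegrableOn (fun u : ℝ => u ^ p * Real.exp (-(ε * u))) (Ioi 0) := by
  have := integrableOn_rpow_mul_exp_neg_mul_rpow (s := p) (p := 1) (b := ε) hp one_pos hε
  refine this.congr_fun (fun u _ => ?_) measurableSet_Ioi
  simp [neg_mul]

lemma integrableOn_cpow_mul_exp {a r : ℂ} (ha : -1 < a.re) (hr : 0 < r.re) :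
    IntegrableOn (fun u : ℝ => (u : ℂ) ^ a * Complex.exp (-(r * u))) (Ioi 0) := by
  refine Integrable.mono' (integrableOn_rpow_mul_exp_neg ha hr)
    (aestronglyMeasurable_cpow_mul_exp a r le_rfl) ?_
  filter_upwards [ae_restrict_mem measurableSet_Ioi] with u hu
  exact (norm_cpow_mul_exp a r hu).le

lemma differentiableAt_integral_cpow_mul_exp {a r : ℂ} (ha : -1 < a.re) (hr : 0 < r.re) :
    DifferentiableAt ℂ (fun r : ℂ => ∫ u in Ioi (0 : ℝ), (u : ℂ) ^ a * Complex.exp (-(r * u))) r := by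
  have hε : 0 < r.re / 2 := by linarith
  have h := hasDerivAt_integral_of_dominated_loc_of_deriv_le (𝕜 := ℂ)
    (μ := volume.restrict (Ioi (0 : ℝ)))
    (F := fun (r : ℂ) (u : ℝ) => (u : ℂ) ^ a * Complex.exp (-(r * u)))
    (F' := fun (r : ℂ) (u : ℝ) => -(u : ℂ) * ((u : ℂ) ^ a * Complex.exp (-(r * u))))
    (bound := fun u : ℝ => u ^ (a.re + 1) * Real.exp (-(r.re / 2 * u))) (x₀ := r)
    (Metric.ball_mem_nhds r hε)
    (Eventually.of_forall fun r => aestronglyMeasurable_cpow_mul_exp a r le_rfl)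
    (integrableOn_cpow_mul_exp ha hr)
    ((Continuous.aestronglyMeasurable (by fun_prop)).mul
      (aestronglyMeasurable_cpow_mul_exp a r le_rfl))
    ?_ (integrableOn_rpow_mul_exp_neg (by linarith) hε) ?_
  · exact h.2.differentiableAt
  · filter_upwards [ae_restrict_mem measurableSet_Ioi] with u hu z hz
    have hu0 : 0 < u := hu
    rw [norm_mul, norm_cpow_mul_exp _ _ hu0, norm_neg, Complex.norm_real, Real.norm_eq_abs,
      abs_of_pos hu0, Real.rpow_add_one hu0.ne']
    have h1 : r.re / 2 ≤ z.re := by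
      have := (Complex.abs_re_le_norm (z - r)).trans (mem_ball_iff_norm.1 hz).le
      rw [Complex.sub_re] at this
      linarith [neg_abs_le (z.re - r.re)]
    rw [← mul_assoc, mul_comm u]
    gcongr
  · filter_upwards [ae_restrict_mem measurableSet_Ioi] with u hu z hz
    have := (((hasDerivAt_id z).mul_const (u : ℂ)).neg.cexp).const_mul ((u : ℂ) ^ a)
    convert! this using 1
    simp
    ring

lemma isPreconnected_re_pos : IsPreconnected {r : ℂ | 0 < r.re} :=
  (convex_halfSpace_re_gt 0).isPreconnected

/-- Extension of `Complex.integral_cpow_mul_exp_neg_mul_Ioi` from positive real `r` to the right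
half-plane, by the identity theorem. -/
lemma integral_cpow_mul_exp_neg_mul_Ioi_of_re_pos {a r : ℂ} (ha : 0 < a.re) (hr : 0 < r.re) :
    ∫ u in Ioi (0 : ℝ), (u : ℂ) ^ (a - 1) * Complex.exp (-(r * u)) =
      (1 / r) ^ a * Complex.Gamma a := by
  have hopen : IsOpen {r : ℂ | 0 < r.re} := isOpen_lt continuous_const Complex.continuous_re
  have h1 : AnalyticOnNhd ℂ
      (fun r : ℂ => ∫ u in Ioi (0 : ℝ), (u : ℂ) ^ (a - 1) * Complex.exp (-(r * u)))
      {r : ℂ | 0 < r.re} := by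
    refine DifferentiableOn.analyticOnNhd (fun z hz => ?_) hopen
    exact (differentiableAt_integral_cpow_mul_exp (by simpa using ha) hz).differentiableWithinAt
  have h2 : AnalyticOnNhd ℂ (fun r : ℂ => (1 / r) ^ a * Complex.Gamma a) {r : ℂ | 0 < r.re} := by
    refine DifferentiableOn.analyticOnNhd (fun z hz => ?_) hopen
    have hz' : 0 < z.re := hz
    have hz0 : z ≠ 0 := by rintro rfl; simp at hz'
    refine DifferentiableAt.differentiableWithinAt (DifferentiableAt.mul_const ?_ _)
    refine DifferentiableAt.cpow_const ?_ ?_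
    · exact (differentiableAt_const _).div differentiableAt_id hz0
    · left
      rw [one_div, Complex.inv_re]
      have := Complex.normSq_pos.2 hz0
      positivity
  refine h1.eqOn_of_preconnected_of_frequently_eq h2 isPreconnected_re_pos (z₀ := 1) (by simp) ?_ hr
  -- the two sides agree at the reals `1 + 1 / (n + 1)`, which accumulate at `1`
  have ht : Tendsto (fun n : ℕ => ((1 + 1 / ((n : ℝ) + 1) : ℝ) : ℂ)) atTop (𝓝[≠] 1) := by
    refine tendsto_nhdsWithin_iff.2 ⟨?_, Eventually.of_forall fun n => ?_⟩
    · have := (tendsto_one_div_add_atTop_nhds_zero_nat (𝕜 := ℝ)).const_add 1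
      rw [add_zero] at this
      exact (Complex.continuous_ofReal.tendsto 1).comp this |>.trans (by simp)
    · have : (0 : ℝ) < 1 / ((n : ℝ) + 1) := by positivity
      rw [mem_compl_iff, mem_singleton_iff, Complex.ofReal_eq_one]
      linarith
  refine ht.frequently (Eventually.frequently (Eventually.of_forall fun n => ?_))
  exact Complex.integral_cpow_mul_exp_neg_mul_Ioi ha (by positivity)

/-- The value of the integral `∫₀^∞ u^{-s} e^{-ru} du`, with the part over `(x, ∞)` integrated by
parts once. In this form both sides make sense, and are continuous, up to the imaginary axis. -/
lemma integral_split_eq_Gamma {s r : ℂ} (hσ : 0 < s.re) (hσ1 : s.re < 1) (hr : 0 < r.re) {x : ℝ}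
    (hx : 0 < x) :
    (∫ u in Ioc 0 x, (u : ℂ) ^ (-s) * Complex.exp (-(r * u))) +
      ((x : ℂ) ^ (-s) * Complex.exp (-(r * x)) / r -
        s / r * ∫ u in Ioi x, (u : ℂ) ^ (-s - 1) * Complex.exp (-(r * u))) =
      (1 / r) ^ (1 - s) * Complex.Gamma (1 - s) := by
  have hr0 : r ≠ 0 := by rintro rfl; simp at hr
  have hint := integrableOn_cpow_mul_exp (a := -s) (r := r) (by simpa using hσ1) hr
  have hint' : IntegrableOn (fun u : ℝ => (u : ℂ) ^ (-s - 1) * Complex.exp (-(r * u))) (Ioi x) := by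
    refine Integrable.mono' (integrableOn_Ioi_rpow_of_lt (a := -s.re - 1) (by linarith) hx)
      (aestronglyMeasurable_cpow_mul_exp _ r hx.le) ?_
    filter_upwards [ae_restrict_mem measurableSet_Ioi] with u hu
    have hu0 : 0 < u := hx.trans hu
    rw [norm_cpow_mul_exp _ _ hu0]
    have : Real.exp (-(r.re * u)) ≤ 1 := Real.exp_le_one_iff.2 (by nlinarith)
    calc _ ≤ u ^ (-s - 1).re * 1 := by gcongr
      _ = _ := by simp
  have hderiv : ∀ u ∈ Ici x, HasDerivAt
      (fun u : ℝ => -((u : ℂ) ^ (-s) * Complex.exp (-(r * u)) / r))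
      ((u : ℂ) ^ (-s) * Complex.exp (-(r * u)) +
        s / r * ((u : ℂ) ^ (-s - 1) * Complex.exp (-(r * u)))) u := by
    intro u hu
    have hu0 : 0 < u := hx.trans_le hu
    have hs0 : -s ≠ 0 := by
      rw [neg_ne_zero]; rintro rfl; simp at hσ
    have h1 := hasDerivAt_ofReal_cpow_const hu0.ne' hs0
    have h2 := ((hasDerivAt_id u).ofReal_comp.const_mul r).neg.cexp
    have h := ((h1.mul h2).div_const r).neg
    convert! h using 1
    simp only [id, Complex.ofReal_one, Pi.neg_apply]
    field_simp
    ring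
  have hlim : Tendsto (fun u : ℝ => -((u : ℂ) ^ (-s) * Complex.exp (-(r * u)) / r)) atTop
      (𝓝 0) := by
    have h0 : Tendsto (fun u : ℝ => u ^ (-s.re) / ‖r‖) atTop (𝓝 0) := by
      simpa using (tendsto_rpow_neg_atTop hσ).div_const ‖r‖
    refine squeeze_zero_norm' ?_ h0
    filter_upwards [eventually_gt_atTop 0] with u hu
    rw [norm_neg, norm_div, norm_cpow_mul_exp _ _ hu]
    have : Real.exp (-(r.re * u)) ≤ 1 := Real.exp_le_one_iff.2 (by nlinarith)
    gcongr
    calc _ ≤ u ^ (-s).re * 1 := by gcongr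
      _ = _ := by simp
  have hx_sub : Ioi x ⊆ Ioi (0 : ℝ) := Ioi_subset_Ioi hx.le
  have hparts := integral_Ioi_of_hasDerivAt_of_tendsto' hderiv
    ((hint.mono_set hx_sub).add (hint'.const_mul _)) hlim
  rw [integral_add (hint.mono_set hx_sub) (hint'.const_mul _), integral_const_mul] at hparts
  have hG := integral_cpow_mul_exp_neg_mul_Ioi_of_re_pos (a := 1 - s) (r := r)
    (by simpa using hσ1) hr
  rw [show (1 - s - 1) = -s by ring, ← Ioc_union_Ioi_eq_Ioi hx.le,
    setIntegral_union (by simp [Set.disjoint_left]) measurableSet_Ioi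
      (hint.mono_set Ioc_subset_Ioi_self) (hint.mono_set hx_sub)] at hG
  rw [← hG]
  linear_combination (norm := ring_nf) -hparts

/-- The case `r = -iω` of `integral_split_eq_Gamma`, obtained as the limit from `r = ε - iω`. -/
lemma integral_split_eq_Gamma_of_imaginary {s : ℂ} (hσ : 0 < s.re) (hσ1 : s.re < 1) {x ω : ℝ}
    (hx : 0 < x) (hω : 0 < ω) :
    (∫ u in Ioc 0 x, (u : ℂ) ^ (-s) * Complex.exp (-(-(ω * Complex.I) * u))) +
      ((x : ℂ) ^ (-s) * Complex.exp (-(-(ω * Complex.I) * x)) / (-(ω * Complex.I)) -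
        s / (-(ω * Complex.I)) *
          ∫ u in Ioi x, (u : ℂ) ^ (-s - 1) * Complex.exp (-(-(ω * Complex.I) * u))) =
      (1 / (-(ω * Complex.I))) ^ (1 - s) * Complex.Gamma (1 - s) := by
  have hωC : (ω : ℂ) ≠ 0 := by exact_mod_cast hω.ne'
  set r : ℝ → ℂ := fun ε => ε - ω * Complex.I with hr
  have hr0 : r 0 = -(ω * Complex.I) := by simp [hr]
  have hrre : ∀ ε, (r ε).re = ε := fun ε => by simp [hr]
  have hrc : Continuous r := by fun_prop
  have hrne : r 0 ≠ 0 := by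
    rw [hr0]; simpa using hωC
  rw [← hr0]
  have hev : ∀ᶠ ε : ℝ in 𝓝[>] 0, 0 < ε := eventually_mem_nhdsWithin
  have hexp : ∀ ε u : ℝ, 0 < ε → 0 < u → Real.exp (-((r ε).re * u)) ≤ 1 := fun ε u h1 h2 => by
    rw [hrre]; exact Real.exp_le_one_iff.2 (by nlinarith)
  have hrt : Tendsto r (𝓝[>] 0) (𝓝 (r 0)) := hrc.continuousAt.tendsto.mono_left nhdsWithin_le_nhds
  have hlow : Tendsto (fun ε => ∫ u in Ioc 0 x, (u : ℂ) ^ (-s) * Complex.exp (-(r ε * u)))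
      (𝓝[>] 0) (𝓝 (∫ u in Ioc 0 x, (u : ℂ) ^ (-s) * Complex.exp (-(r 0 * u)))) := by
    refine tendsto_integral_filter_of_dominated_convergence (fun u : ℝ => u ^ (-s.re)) ?_ ?_ ?_ ?_
    · exact Eventually.of_forall fun ε =>
        (aestronglyMeasurable_cpow_mul_exp _ _ le_rfl).mono_set Ioc_subset_Ioi_self
    · filter_upwards [hev] with ε hε
      filter_upwards [ae_restrict_mem measurableSet_Ioc] with u hu
      rw [norm_cpow_mul_exp _ _ hu.1, Complex.neg_re]
      exact mul_le_of_le_one_right (Real.rpow_nonneg hu.1.le _) (hexp ε u hε hu.1)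
    · exact (intervalIntegrable_iff_integrableOn_Ioc_of_le hx.le).1
        (intervalIntegral.intervalIntegrable_rpow' (by linarith))
    · filter_upwards with u
      exact ((hrt.mul_const (u : ℂ)).neg.cexp).const_mul _
  have hup : Tendsto (fun ε => ∫ u in Ioi x, (u : ℂ) ^ (-s - 1) * Complex.exp (-(r ε * u)))
      (𝓝[>] 0) (𝓝 (∫ u in Ioi x, (u : ℂ) ^ (-s - 1) * Complex.exp (-(r 0 * u)))) := by
    refine tendsto_integral_filter_of_dominated_convergence (fun u : ℝ => u ^ (-s.re - 1))
      ?_ ?_ ?_ ?_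
    · exact Eventually.of_forall fun ε => aestronglyMeasurable_cpow_mul_exp _ _ hx.le
    · filter_upwards [hev] with ε hε
      filter_upwards [ae_restrict_mem measurableSet_Ioi] with u hu
      have hu0 : 0 < u := hx.trans hu
      rw [norm_cpow_mul_exp _ _ hu0, Complex.sub_re, Complex.neg_re, Complex.one_re]
      exact mul_le_of_le_one_right (Real.rpow_nonneg hu0.le _) (hexp ε u hε hu0)
    · exact integrableOn_Ioi_rpow_of_lt (by linarith) hx
    · filter_upwards with u
      exact ((hrt.mul_const (u : ℂ)).neg.cexp).const_mul _
  have hbdry : Tendsto (fun ε => (x : ℂ) ^ (-s) * Complex.exp (-(r ε * x)) / r ε) (𝓝[>] 0)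
      (𝓝 ((x : ℂ) ^ (-s) * Complex.exp (-(r 0 * x)) / r 0)) :=
    (((hrt.mul_const (x : ℂ)).neg.cexp).const_mul _).div hrt hrne
  have hrhs : Tendsto (fun ε => (1 / r ε) ^ (1 - s) * Complex.Gamma (1 - s)) (𝓝[>] 0)
      (𝓝 ((1 / r 0) ^ (1 - s) * Complex.Gamma (1 - s))) := by
    refine Tendsto.mul_const _ ?_
    refine Tendsto.cpow (tendsto_const_nhds.div hrt hrne) tendsto_const_nhds ?_
    right
    rw [hr0, one_div, Complex.inv_im]
    simp [hω.ne']
  have hlhs := hlow.add (hbdry.sub ((tendsto_const_nhds.div hrt hrne : Tendsto (fun ε => s / r ε)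
    (𝓝[>] 0) (𝓝 (s / r 0))).mul hup))
  refine tendsto_nhds_unique (hlhs.congr' ?_) hrhs
  filter_upwards [hev] with ε hε
  exact integral_split_eq_Gamma hσ hσ1 (by rwa [hrre]) hx

lemma one_div_neg_mul_I_cpow (s : ℂ) {ω : ℝ} (hω : 0 < ω) :
    (1 / (-(ω * Complex.I))) ^ (1 - s) =
      Complex.I * (ω : ℂ) ^ (s - 1) * Complex.exp (-((π : ℂ) * Complex.I * s / 2)) := by
  have hωC : (ω : ℂ) ≠ 0 := by exact_mod_cast hω.ne'
  have h1 : 1 / (-(ω * Complex.I)) = ((ω⁻¹ : ℝ) : ℂ) * Complex.I := by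
    push_cast
    rw [one_div, inv_neg, mul_inv, Complex.inv_I]
    ring
  have hI : Complex.exp (π / 2 * Complex.I) = Complex.I := Complex.exp_pi_div_two_mul_I
  rw [h1, Complex.cpow_def_of_ne_zero (by simpa using hωC),
    Complex.log_ofReal_mul (inv_pos.2 hω) Complex.I_ne_zero, Complex.log_I, Real.log_inv,
    Complex.cpow_def_of_ne_zero hωC, ← Complex.ofReal_log hω.le]
  nth_rewrite 2 [← hI]
  rw [← Complex.exp_add, ← Complex.exp_add]
  congr 1
  push_cast
  ring

end RotatedGamma

/-- For every `ν ≥ 1` the upper and the lower term add up to the `ν`-th term of the dual sum and a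
boundary term. -/
lemma upperTerm_eq {s : ℂ} {α x : ℝ} {ν : ℕ} (hσ : 0 < s.re) (hσ1 : s.re < 1) (hx : 0 < x)
    (hν : 1 ≤ ν) :
    upperTerm s α x ν =
      (x : ℂ) ^ (-s) * (Complex.exp (2 * (π : ℂ) * Complex.I * (ν : ℂ) * ((x : ℂ) - (α : ℂ))) /
        (2 * (π : ℂ) * Complex.I * (ν : ℂ))) - lowerTerm s α x ν +
      Complex.I * (2 * (π : ℂ)) ^ (s - 1) * Complex.Gamma (1 - s) *
        Complex.exp (-((π : ℂ) * Complex.I * s / 2)) *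
        (Complex.exp (-(2 * (π : ℂ) * Complex.I * (ν : ℂ) * (α : ℂ))) * (ν : ℂ) ^ (s - 1)) := by
  have hν0 : (0 : ℝ) < ν := by exact_mod_cast hν
  have hνC : (ν : ℂ) ≠ 0 := by exact_mod_cast hν0.ne'
  have hπC : (π : ℂ) ≠ 0 := by exact_mod_cast Real.pi_ne_zero
  set e : ℂ := Complex.exp (-(2 * (π : ℂ) * Complex.I * (ν : ℂ) * (α : ℂ))) with he
  have hexp : ∀ u : ℝ, Complex.exp (2 * (π : ℂ) * Complex.I * (ν : ℂ) * ((u : ℂ) - (α : ℂ))) =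
      e * Complex.exp (-(-(((2 * π * ν : ℝ) : ℂ) * Complex.I) * u)) := by
    intro u
    rw [he, ← Complex.exp_add]
    congr 1
    push_cast
    ring
  have hwave : ∀ (w : ℂ) (u : ℝ), wave α (ν : ℤ) w u =
      e * ((u : ℂ) ^ (-w) * Complex.exp (-(-(((2 * π * ν : ℝ) : ℂ) * Complex.I) * u))) := by
    intro w u
    rw [wave_eq_mul_cpow, Int.cast_natCast, hexp]
    ring
  have h := integral_split_eq_Gamma_of_imaginary (ω := 2 * π * ν) hσ hσ1 hx (by positivity)
  rw [one_div_neg_mul_I_cpow s (by positivity)] at h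
  have hpow : (((2 * π * ν : ℝ) : ℂ)) ^ (s - 1) = (2 * (π : ℂ)) ^ (s - 1) * (ν : ℂ) ^ (s - 1) := by
    have := Complex.mul_cpow_ofReal_nonneg (a := 2 * π) (b := ν) (by positivity) hν0.le (s - 1)
    push_cast at this ⊢
    exact this
  rw [hpow] at h
  rw [upperTerm, lowerTerm, intervalIntegral.integral_of_le hx.le]
  simp only [hwave, integral_const_mul]
  rw [hexp x, show -(s + 1) = -s - 1 by ring]
  generalize (∫ u in Ioc 0 x, (u : ℂ) ^ (-s) *
    Complex.exp (-(-(((2 * π * ν : ℝ) : ℂ) * Complex.I) * u))) = A at h ⊢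
  generalize (∫ u in Ioi x, (u : ℂ) ^ (-s - 1) *
    Complex.exp (-(-(((2 * π * ν : ℝ) : ℂ) * Complex.I) * u))) = B at h ⊢
  generalize Complex.exp (-(-(((2 * π * ν : ℝ) : ℂ) * Complex.I) * x)) = X at h ⊢
  push_cast at h
  linear_combination (norm := skip) e * h
  field_simp
  ring

/-! ### The Euler–Maclaurin formula for the Hurwitz zeta function -/

/-- The `1`-periodic extension of the second Bernoulli polynomial `v² - v + 1/6` on `[0, 1]`. -/
noncomputable def periodicBernoulliTwo (v : ℝ) : ℝ := Int.fract v ^ 2 - Int.fract v + 1 / 6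

lemma abs_periodicBernoulliTwo_le (v : ℝ) : |periodicBernoulliTwo v| ≤ 1 := by
  have h0 := Int.fract_nonneg v
  have h1 := (Int.fract_lt_one v).le
  rw [periodicBernoulliTwo, abs_le]
  constructor <;> nlinarith

lemma measurable_periodicBernoulliTwo : Measurable periodicBernoulliTwo := by
  unfold periodicBernoulliTwo
  fun_prop

lemma periodicBernoulliTwo_eq {v : ℝ} {k : ℤ} (h1 : (k : ℝ) ≤ v) (h2 : v ≤ k + 1) :
    periodicBernoulliTwo v = (v - k) ^ 2 - (v - k) + 1 / 6 := by
  rcases h2.eq_or_lt with h | h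
  -- at the right endpoint the fractional part jumps to `0`, but `B₂(0) = B₂(1)`
  · have : Int.fract v = 0 := by
      rw [h, ← Int.cast_one, ← Int.cast_add, Int.fract_intCast]
    rw [periodicBernoulliTwo, this, h]
    ring
  · have : ⌊v⌋ = k := Int.floor_eq_iff.2 ⟨h1, h⟩
    rw [periodicBernoulliTwo, Int.fract, this]

/-- The integral `∫_x^∞ B₂({u - α}) u^{-s-2} du`. -/
noncomputable def bernoulliIntegral (s : ℂ) (α x : ℝ) : ℂ :=
  ∫ u in Ioi x, (periodicBernoulliTwo (u - α) : ℂ) * (u : ℂ) ^ (-s - 2)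

lemma integrableOn_bernoulli {s : ℂ} (hs : -1 < s.re) (α : ℝ) {x : ℝ} (hx : 0 < x) :
    IntegrableOn (fun u : ℝ => (periodicBernoulliTwo (u - α) : ℂ) * (u : ℂ) ^ (-s - 2))
      (Ioi x) := by
  have h1 : IntegrableOn (fun u : ℝ => (u : ℂ) ^ (-s - 2)) (Ioi x) :=
    integrableOn_Ioi_cpow_of_lt (by simp; linarith) hx
  refine Integrable.bdd_mul (c := 1) h1 ?_ (Eventually.of_forall fun u => ?_)
  · exact (Complex.measurable_ofReal.comp
      (measurable_periodicBernoulliTwo.comp (measurable_id.sub_const α))).aestronglyMeasurable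
  · rw [Complex.norm_real]; exact abs_periodicBernoulliTwo_le _

/-- An antiderivative of `s (s + 1) / 2 * B₂(u - a) u^{-s-2}`, `B₂` being the Bernoulli
polynomial. -/
noncomputable def bernoulliPrimitive (s : ℂ) (a u : ℝ) : ℂ :=
  (u : ℂ) ^ (1 - s) / (1 - s) - ((u : ℂ) - a - 1 / 2) * (u : ℂ) ^ (-s) -
    s / 2 * (((u : ℂ) - a) ^ 2 - (u - a) + 1 / 6) * (u : ℂ) ^ (-s - 1)

lemma hasDerivAt_bernoulliPrimitive {s : ℂ} (hs : 1 < s.re) (a : ℝ) {u : ℝ} (hu : 0 < u) :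
    HasDerivAt (bernoulliPrimitive s a)
      (s * (s + 1) / 2 * ((((u : ℂ) - a) ^ 2 - (u - a) + 1 / 6) * (u : ℂ) ^ (-s - 2))) u := by
  have huC : (u : ℂ) ≠ 0 := by exact_mod_cast hu.ne'
  have hne : ∀ z : ℂ, z.re ≠ 0 → z ≠ 0 := fun z h hz => h (by rw [hz, Complex.zero_re])
  have hs1 : 1 - s ≠ 0 := hne _ (by simp; linarith)
  have hs0 : -s ≠ 0 := hne _ (by simp; linarith)
  have hs2 : -s - 1 ≠ 0 := hne _ (by simp; linarith)
  have hid := ((hasDerivAt_id u).ofReal_comp).sub_const (a : ℂ)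
  have h1 := (hasDerivAt_ofReal_cpow_const hu.ne' hs1).div_const (1 - s)
  have h2 := (hid.sub_const (1 / 2)).mul (hasDerivAt_ofReal_cpow_const hu.ne' hs0)
  have h3 := ((((hid.pow 2).sub hid).add_const (1 / 6)).const_mul (s / 2)).mul
    (hasDerivAt_ofReal_cpow_const hu.ne' hs2)
  have h := (h1.sub h2).sub h3
  convert! h using 1
  simp only [id, Complex.ofReal_one, Pi.pow_apply, Pi.sub_apply]
  have e1 : (u : ℂ) ^ (-s - 1) = u * (u : ℂ) ^ (-s - 2) := by
    rw [show -s - 1 = 1 + (-s - 2) by ring, Complex.cpow_add _ _ huC, Complex.cpow_one]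
  have e2 : (u : ℂ) ^ (-s) = u * (u * (u : ℂ) ^ (-s - 2)) := by
    rw [← e1]
    nth_rewrite 1 [show -s = 1 + (-s - 1) by ring]
    rw [Complex.cpow_add _ _ huC, Complex.cpow_one]
  rw [show 1 - s - 1 = -s by ring, show -s - 1 - 1 = -s - 2 by ring, e2, e1]
  field_simp
  ring

/-- The fundamental theorem of calculus within a single unit interval `[k + α, k + α + 1]`. -/
lemma integral_bernoulli_eq_sub {s : ℂ} (hs : 1 < s.re) (α : ℝ) (k : ℤ) {b c : ℝ} (hb : 0 < b)
    (hbc : b ≤ c) (hkb : k + α ≤ b) (hck : c ≤ k + α + 1) :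
    ∫ u in b..c, s * (s + 1) / 2 * ((periodicBernoulliTwo (u - α) : ℂ) * (u : ℂ) ^ (-s - 2)) =
      bernoulliPrimitive s (k + α) c - bernoulliPrimitive s (k + α) b := by
  have hd : ∀ u ∈ uIcc b c, HasDerivAt (bernoulliPrimitive s (k + α))
      (s * (s + 1) / 2 * ((((u : ℂ) - (k + α : ℝ)) ^ 2 - (u - (k + α : ℝ)) + 1 / 6) *
        (u : ℂ) ^ (-s - 2))) u := by
    intro u hu
    rw [uIcc_of_le hbc] at hu
    exact hasDerivAt_bernoulliPrimitive hs _ (hb.trans_le hu.1)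
  rw [← intervalIntegral.integral_eq_sub_of_hasDerivAt hd]
  · refine intervalIntegral.integral_congr fun u hu => ?_
    rw [uIcc_of_le hbc] at hu
    rw [periodicBernoulliTwo_eq (k := k) (by linarith [hu.1]) (by linarith [hu.2])]
    push_cast
    ring
  · refine ContinuousOn.intervalIntegrable fun u hu => ?_
    rw [uIcc_of_le hbc] at hu
    have : 0 < u := hb.trans_le hu.1
    refine ContinuousAt.continuousWithinAt ?_
    have := Complex.continuousAt_ofReal_cpow_const u (-s - 2) (Or.inr this.ne')
    fun_prop

/-- Passing from one unit interval to the next, the antiderivative jumps by a term of the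
Hurwitz series. -/
lemma bernoulliPrimitive_add_one_sub (s : ℂ) (a : ℝ) :
    bernoulliPrimitive s (a + 1) (a + 1) - bernoulliPrimitive s a (a + 1) =
      ((a : ℂ) + 1) ^ (-s) := by
  unfold bernoulliPrimitive
  push_cast
  ring

lemma integral_bernoulli_eq_sub_sum {s : ℂ} (hs : 1 < s.re) {α x : ℝ} (hx : 0 < x)
    {N : ℕ} (h1 : (N : ℝ) - 1 + α ≤ x) (h2 : x ≤ N + α) (m : ℕ) :
    ∫ u in x..(N + m + α),
        s * (s + 1) / 2 * ((periodicBernoulliTwo (u - α) : ℂ) * (u : ℂ) ^ (-s - 2)) =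
      bernoulliPrimitive s (N + m + α) (N + m + α) - bernoulliPrimitive s (N - 1 + α) x -
        ∑ j ∈ Finset.range (m + 1), (((j + N : ℕ) : ℂ) + α) ^ (-s) := by
  induction m with
  | zero =>
    have hE := integral_bernoulli_eq_sub hs α ((N : ℤ) - 1) hx h2
      (by push_cast; exact h1) (by push_cast; linarith)
    have hJ := bernoulliPrimitive_add_one_sub s ((N : ℝ) - 1 + α)
    rw [show (N : ℝ) - 1 + α + 1 = N + α by ring] at hJ
    push_cast at hE hJ ⊢
    rw [add_zero, hE]
    simp only [zero_add, Finset.sum_range_one, Nat.cast_zero]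
    rw [show (N : ℂ) + α = N - 1 + α + 1 by ring, ← hJ]
    ring
  | succ m ih =>
    have hm : (0 : ℝ) ≤ m := m.cast_nonneg
    have hE := integral_bernoulli_eq_sub hs α ((N : ℤ) + m) (b := N + m + α) (c := N + m + α + 1)
      (by linarith) (by linarith) (by push_cast; linarith) (by push_cast; linarith)
    have hJ := bernoulliPrimitive_add_one_sub s ((N : ℝ) + m + α)
    have hint : ∀ b c : ℝ, 0 < b → b ≤ c → IntervalIntegrable (fun u : ℝ =>
        s * (s + 1) / 2 * ((periodicBernoulliTwo (u - α) : ℂ) * (u : ℂ) ^ (-s - 2)))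
        volume b c := fun b c hb hbc => by
      rw [intervalIntegrable_iff_integrableOn_Ioc_of_le hbc]
      exact ((integrableOn_bernoulli (by linarith) α hb).mono_set Ioc_subset_Ioi_self).const_mul _
    rw [show (N : ℝ) + (m + 1 : ℕ) + α = N + m + α + 1 by push_cast; ring,
      ← intervalIntegral.integral_add_adjacent_intervals
        (hint x (N + m + α) hx (by linarith)) (hint (N + m + α) _ (by linarith) (by linarith)),
      ih, Finset.sum_range_succ _ (m + 1)]
    push_cast at hE hJ ⊢
    rw [hE, show (m : ℂ) + 1 + N + α = N + m + α + 1 by ring, ← hJ]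
    ring

lemma tendsto_bernoulliPrimitive_self {s : ℂ} (hs : 1 < s.re) :
    Tendsto (fun a : ℝ => bernoulliPrimitive s a a) atTop (𝓝 0) := by
  have hz : ∀ z : ℂ, z.re < 0 → Tendsto (fun a : ℝ => (a : ℂ) ^ z) atTop (𝓝 0) := by
    intro z hz
    have h0 : Tendsto (fun a : ℝ => a ^ z.re) atTop (𝓝 0) := by
      simpa using tendsto_rpow_neg_atTop (y := -z.re) (by linarith)
    refine squeeze_zero_norm' ?_ h0
    filter_upwards [eventually_gt_atTop 0] with a ha
    exact (Complex.norm_cpow_eq_rpow_re_of_pos ha z).le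
  have h1 := (hz (1 - s) (by simp; linarith)).div_const (1 - s)
  have h2 := (hz (-s) (by simp; linarith)).const_mul (1 / 2 : ℂ)
  have h3 := (hz (-s - 1) (by simp; linarith)).const_mul (s / 12)
  have h := (h1.add h2).sub h3
  simp only [zero_div, mul_zero, add_zero, sub_zero] at h
  refine h.congr fun a => ?_
  unfold bernoulliPrimitive
  ring

lemma mainSum_eq_sum_range (s : ℂ) (α x : ℝ) {N : ℕ} (hN : (N : ℤ) = ⌊x - α⌋ + 1) :
    mainSum s α x = ∑ n ∈ Finset.range N, ((n : ℂ) + α) ^ (-s) := by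
  rw [mainSum]
  symm
  refine Finset.sum_nbij' (fun n : ℕ => (n : ℤ)) (fun n : ℤ => n.toNat) ?_ ?_ ?_ ?_ ?_
  · intro n hn; simp only [Finset.mem_range, Finset.mem_Icc] at hn ⊢; omega
  · intro n hn; simp only [Finset.mem_range, Finset.mem_Icc] at hn ⊢; omega
  · intro n hn; simp
  · intro n hn; simp only [Finset.mem_Icc] at hn; omega
  · intro n hn; simp

/-- The right-hand side of the Euler–Maclaurin formula of order two for the Hurwitz zeta
function. -/
noncomputable def eulerMaclaurinTwo (s : ℂ) (α x : ℝ) : ℂ :=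
  mainSum s α x + (x : ℂ) ^ (1 - s) / (s - 1) + psi (x - α) * (x : ℂ) ^ (-s) +
    s / 2 * periodicBernoulliTwo (x - α) * (x : ℂ) ^ (-s - 1) -
      s * (s + 1) / 2 * bernoulliIntegral s α x

lemma hurwitzZeta_eq_eulerMaclaurinTwo_of_one_lt_re {s : ℂ} (hs : 1 < s.re) {α x : ℝ}
    (hα : 0 < α) (hα1 : α ≤ 1) (hx : 0 < x) :
    HurwitzZeta.hurwitzZeta (α : UnitAddCircle) s = eulerMaclaurinTwo s α x := by
  have hfl : -1 ≤ ⌊x - α⌋ := by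
    rw [Int.le_floor]; push_cast; linarith
  -- `N` is the number of terms of the main sum; it is `0` when `x < α`
  obtain ⟨N, hN⟩ : ∃ N : ℕ, (N : ℤ) = ⌊x - α⌋ + 1 := ⟨(⌊x - α⌋ + 1).toNat, by omega⟩
  have hNR : (⌊x - α⌋ : ℝ) = N - 1 := by
    have : ((N : ℤ) : ℝ) = ((⌊x - α⌋ + 1 : ℤ) : ℝ) := by rw [hN]
    push_cast at this
    linarith
  have h1 : (N : ℝ) - 1 + α ≤ x := by linarith [Int.floor_le (x - α)]
  have h2 : x < N + α := by linarith [Int.lt_floor_add_one (x - α)]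
  have hsum : HasSum (fun n : ℕ => ((n : ℂ) + α) ^ (-s))
      (HurwitzZeta.hurwitzZeta (α : UnitAddCircle) s) := by
    have := HurwitzZeta.hasSum_hurwitzZeta_of_one_lt_re ⟨hα.le, hα1⟩ hs
    simpa only [one_div, ← Complex.cpow_neg] using this
  have hshift := ((hasSum_nat_add_iff' N).2 hsum).tendsto_sum_nat.comp (tendsto_add_atTop_nat 1)
  have hatTop : Tendsto (fun m : ℕ => (N : ℝ) + m + α) atTop atTop := by
    refine tendsto_atTop_add_const_right _ _ ?_
    exact tendsto_atTop_add_const_left _ _ tendsto_natCast_atTop_atTop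
  have hI := intervalIntegral_tendsto_integral_Ioi x
    ((integrableOn_bernoulli (by linarith : -1 < s.re) α hx).const_mul (s * (s + 1) / 2)) hatTop
  have hP := (tendsto_bernoulliPrimitive_self hs).comp hatTop
  have hlim := (hP.sub_const (bernoulliPrimitive s (N - 1 + α) x)).sub hshift
  have heq := tendsto_nhds_unique hI (hlim.congr fun m => by
    rw [integral_bernoulli_eq_sub_sum hs hx h1 h2.le m]; rfl)
  rw [integral_const_mul] at heq
  have hpsi : x - (N - 1 + α) - 1 / 2 = psi (x - α) := by rw [psi, hNR]; ring
  have hB : (x - (N - 1 + α)) ^ 2 - (x - (N - 1 + α)) + 1 / 6 = periodicBernoulliTwo (x - α) := by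
    rw [periodicBernoulliTwo, Int.fract, hNR]; ring
  rw [eulerMaclaurinTwo, mainSum_eq_sum_range s α x hN, bernoulliIntegral, ← hpsi, ← hB]
  rw [bernoulliPrimitive] at heq
  rw [show (x : ℂ) ^ (1 - s) / (s - 1) = -((x : ℂ) ^ (1 - s) / (1 - s)) by
    rw [← neg_sub 1 s, div_neg]]
  push_cast at heq ⊢
  linear_combination heq

lemma differentiableAt_bernoulliIntegral {s : ℂ} (hs : -1 < s.re) (α : ℝ) {x : ℝ} (hx : 0 < x) :
    DifferentiableAt ℂ (fun s => bernoulliIntegral s α x) s := by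
  set f : ℝ → ℂ := (Ioi x).indicator fun u => (periodicBernoulliTwo (u - α) : ℂ) with hf
  have hfm : Measurable f := (Complex.measurable_ofReal.comp
      (measurable_periodicBernoulliTwo.comp (measurable_id.sub_const α))).indicator
        measurableSet_Ioi
  have hfb : ∀ u, ‖f u‖ ≤ 1 := by
    intro u
    refine (norm_indicator_le_norm_self _ _).trans ?_
    rw [Complex.norm_real]; exact abs_periodicBernoulliTwo_le _
  have hfi : LocallyIntegrableOn f (Ioi 0) := by
    refine LocallyIntegrable.locallyIntegrableOn ?_ _
    exact (locallyIntegrable_const (1 : ℝ)).mono hfm.aestronglyMeasurable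
      (Eventually.of_forall fun u => by simpa using hfb u)
  -- the integral is the Mellin transform at `-s - 1` of a bounded function vanishing near `0`
  have heq : (fun s => bernoulliIntegral s α x) = fun s => mellin f (-s - 1) := by
    funext z
    rw [bernoulliIntegral, mellin, ← integral_indicator measurableSet_Ioi,
      ← integral_indicator measurableSet_Ioi]
    congr 1
    funext u
    by_cases hu : x < u
    · rw [indicator_of_mem (show u ∈ Ioi x from hu),
        indicator_of_mem (show u ∈ Ioi (0 : ℝ) from hx.trans hu), hf,
        indicator_of_mem (show u ∈ Ioi x from hu), smul_eq_mul, mul_comm]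
      congr 2
      ring
    · rw [indicator_of_notMem (show u ∉ Ioi x from hu)]
      by_cases hu0 : u ∈ Ioi (0 : ℝ)
      · rw [indicator_of_mem hu0, hf, indicator_of_notMem (show u ∉ Ioi x from hu), smul_zero]
      · rw [indicator_of_notMem hu0]
  rw [heq]
  have hm : DifferentiableAt ℂ (mellin f) (-s - 1) := by
    refine mellin_differentiableAt_of_isBigO_rpow (a := 0) (b := (-s - 1).re - 1) hfi ?_
      (by simp; linarith) ?_ (by linarith)
    · simp only [neg_zero, Real.rpow_zero]
      exact Asymptotics.IsBigO.of_bound 1 (Eventually.of_forall fun u => by simpa using hfb u)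
    · refine Asymptotics.IsBigO.of_bound 1 ?_
      filter_upwards [Ioc_mem_nhdsGT hx] with u hu
      rw [hf, indicator_of_notMem (by simpa using hu.2), norm_zero]
      positivity
  exact DifferentiableAt.comp (g := mellin f) (f := fun s : ℂ => -s - 1) s hm (by fun_prop)

lemma differentiableAt_eulerMaclaurinTwo {s : ℂ} (hs : 0 < s.re) (hs1 : s ≠ 1) {α x : ℝ}
    (hα : 0 < α) (hx : 0 < x) : DifferentiableAt ℂ (fun s => eulerMaclaurinTwo s α x) s := by
  have hxC : (x : ℂ) ≠ 0 := by exact_mod_cast hx.ne'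
  have hs1' : s - 1 ≠ 0 := sub_ne_zero.2 hs1
  have hR := differentiableAt_bernoulliIntegral (by linarith : -1 < s.re) α hx
  have hpow : ∀ (b : ℂ) (f : ℂ → ℂ), b ≠ 0 → DifferentiableAt ℂ f s →
      DifferentiableAt ℂ (fun z => b ^ f z) s := fun b f hb hf => hf.const_cpow (Or.inl hb)
  have h1 : DifferentiableAt ℂ (fun s => mainSum s α x) s := by
    unfold mainSum
    refine DifferentiableAt.fun_sum fun n hn => hpow _ _ ?_ (by fun_prop)
    have hn0 : (0 : ℝ) ≤ n := by exact_mod_cast (Finset.mem_Icc.1 hn).1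
    have : (n : ℝ) + α ≠ 0 := by positivity
    exact_mod_cast this
  have h2 := hpow (x : ℂ) (fun s => 1 - s) hxC (by fun_prop)
  have h3 := hpow (x : ℂ) (fun s => -s) hxC (by fun_prop)
  have h4 := hpow (x : ℂ) (fun s => -s - 1) hxC (by fun_prop)
  unfold eulerMaclaurinTwo
  fun_prop (disch := assumption)

/-- The punctured half-plane is a chain of four overlapping convex sets. -/
lemma isPreconnected_re_pos_sdiff_one : IsPreconnected {s : ℂ | 0 < s.re ∧ s ≠ 1} := by
  have hA : IsPreconnected ({s : ℂ | 0 < s.re} ∩ {s : ℂ | s.re < 1}) :=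
    ((convex_halfSpace_re_gt 0).inter (convex_halfSpace_re_lt 1)).isPreconnected
  have hB : IsPreconnected ({s : ℂ | 0 < s.re} ∩ {s : ℂ | 0 < s.im}) :=
    ((convex_halfSpace_re_gt 0).inter (convex_halfSpace_im_gt 0)).isPreconnected
  have hC : IsPreconnected ({s : ℂ | 0 < s.re} ∩ {s : ℂ | s.im < 0}) :=
    ((convex_halfSpace_re_gt 0).inter (convex_halfSpace_im_lt 0)).isPreconnected
  have hD : IsPreconnected {s : ℂ | 1 < s.re} := (convex_halfSpace_re_gt 1).isPreconnected
  have hAB := hA.union (1 / 2 + Complex.I) (by norm_num) (by norm_num) hB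
  have hABC := hAB.union (1 / 2 - Complex.I) (Or.inl (by norm_num)) (by norm_num) hC
  have hABCD := hABC.union (2 + Complex.I) (Or.inl (Or.inr (by norm_num))) (by norm_num) hD
  convert! hABCD using 1
  ext s
  simp only [mem_ofPred_eq, mem_union, mem_inter_iff, ne_eq, Complex.ext_iff, Complex.one_re,
    Complex.one_im]
  constructor
  · rintro ⟨h1, h2⟩
    rcases lt_trichotomy s.im 0 with h | h | h
    · tauto
    · rcases lt_trichotomy s.re 1 with h' | h' | h' <;> tauto
    · tauto
  · rintro (((⟨h1, h2⟩ | ⟨h1, h2⟩) | ⟨h1, h2⟩) | h1)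
    · exact ⟨h1, fun h => by linarith [h.1]⟩
    · exact ⟨h1, fun h => by linarith [h.2]⟩
    · exact ⟨h1, fun h => by linarith [h.2]⟩
    · exact ⟨by linarith, fun h => by linarith [h.1]⟩

theorem hurwitzZeta_eq_eulerMaclaurinTwo {s : ℂ} (hs : 0 < s.re) (hs1 : s ≠ 1) {α x : ℝ}
    (hα : 0 < α) (hα1 : α ≤ 1) (hx : 0 < x) :
    HurwitzZeta.hurwitzZeta (α : UnitAddCircle) s = eulerMaclaurinTwo s α x := by
  have hopen : IsOpen {s : ℂ | 0 < s.re ∧ s ≠ 1} :=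
    (isOpen_lt continuous_const Complex.continuous_re).inter isOpen_ne
  have h1 : AnalyticOnNhd ℂ (HurwitzZeta.hurwitzZeta (α : UnitAddCircle))
      {s : ℂ | 0 < s.re ∧ s ≠ 1} :=
    DifferentiableOn.analyticOnNhd (fun z hz =>
      (HurwitzZeta.differentiableAt_hurwitzZeta _ hz.2).differentiableWithinAt) hopen
  have h2 : AnalyticOnNhd ℂ (fun s => eulerMaclaurinTwo s α x) {s : ℂ | 0 < s.re ∧ s ≠ 1} :=
    DifferentiableOn.analyticOnNhd (fun z hz =>
      (differentiableAt_eulerMaclaurinTwo hz.1 hz.2 hα hx).differentiableWithinAt) hopen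
  refine h1.eqOn_of_preconnected_of_eventuallyEq h2 isPreconnected_re_pos_sdiff_one (z₀ := 2)
    (by simp) ?_ ⟨hs, hs1⟩
  filter_upwards [(isOpen_lt continuous_const Complex.continuous_re).mem_nhds
    (show (1 : ℝ) < (2 : ℂ).re by simp)] with z hz
  exact hurwitzZeta_eq_eulerMaclaurinTwo_of_one_lt_re hz hα hα1 hx

/-! ### Fourier expansion of the remainder -/

section FourierSeries

variable {s : ℂ} {α x : ℝ}

lemma integral_wave_by_parts (α : ℝ) (μ : ℤ) {w : ℂ} (hw : 1 < w.re) (hx : 0 < x) :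
    2 * (π : ℂ) * Complex.I * (μ : ℂ) * ∫ u in Ioi x, wave α μ w u =
      (w * ∫ u in Ioi x, wave α μ (w + 1) u) - wave α μ w x := by
  have h1 := integrableOn_wave_Ioi α μ hw hx
  have h2 := integrableOn_wave_Ioi α μ (w := w + 1) (by simp; linarith) hx
  have hlim : Tendsto (wave α μ w) atTop (𝓝 0) := by
    refine squeeze_zero_norm' ?_ (tendsto_rpow_neg_atTop (y := w.re) (by linarith))
    filter_upwards [eventually_gt_atTop 0] with u hu
    exact (norm_wave α μ w hu).le
  have h := integral_Ioi_of_hasDerivAt_of_tendsto'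
    (fun u (hu : u ∈ Ici x) => hasDerivAt_wave α μ w (hx.trans_le hu))
    ((h1.const_mul _).sub (h2.const_mul _)) hlim
  rw [integral_sub (h1.const_mul _) (h2.const_mul _), integral_const_mul, integral_const_mul] at h
  linear_combination h

lemma norm_integral_wave_le_integral (α : ℝ) (μ : ℤ) (w : ℂ) (hx : 0 < x) :
    ‖∫ u in Ioi x, wave α μ w u‖ ≤ ∫ u in Ioi x, u ^ (-w.re) := by
  refine (norm_integral_le_integral_norm _).trans (le_of_eq ?_)
  exact setIntegral_congr_fun measurableSet_Ioi fun u hu => norm_wave α μ w (hx.trans hu)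

/-- The upper term after one more integration by parts, in which the factor `1 / ν²` is explicit.
At `ν = 0` both sides are `0`. -/
lemma upperTerm_eq_second_order (hσ : 0 < s.re) (hx : 0 < x) (ν : ℕ) :
    upperTerm s α x ν = 1 / (ν : ℂ) ^ 2 * (-(s / (4 * π ^ 2)) *
      (((s + 1) * ∫ u in Ioi x, wave α (ν : ℤ) (s + 1 + 1) u) - wave α (ν : ℤ) (s + 1) x)) := by
  rcases Nat.eq_zero_or_pos ν with rfl | hν
  · simp [upperTerm]
  have hνC : (ν : ℂ) ≠ 0 := by exact_mod_cast hν.ne'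
  have hπC : (π : ℂ) ≠ 0 := by exact_mod_cast Real.pi_ne_zero
  rw [← integral_wave_by_parts α (ν : ℤ) (by simpa using hσ) hx, upperTerm]
  push_cast
  field_simp
  rw [Complex.I_sq]
  ring

lemma upperTermNeg_eq_second_order (hσ : 0 < s.re) (hx : 0 < x) (ν : ℕ) :
    upperTermNeg s α x ν = 1 / (ν : ℂ) ^ 2 * (s / (4 * π ^ 2) *
      (((s + 1) * ∫ u in Ioi x, wave α (-(ν : ℤ)) (s + 1 + 1) u) -
        wave α (-(ν : ℤ)) (s + 1) x)) := by
  rcases Nat.eq_zero_or_pos ν with rfl | hν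
  · simp [upperTermNeg]
  have hνC : (ν : ℂ) ≠ 0 := by exact_mod_cast hν.ne'
  have hπC : (π : ℂ) ≠ 0 := by exact_mod_cast Real.pi_ne_zero
  rw [← integral_wave_by_parts α (-(ν : ℤ)) (by simpa using hσ) hx, upperTermNeg]
  push_cast
  field_simp
  rw [Complex.I_sq]
  ring

lemma summable_inv_sq_mul {g : ℕ → ℂ} {B : ℝ} (hg : ∀ ν, ‖g ν‖ ≤ B) :
    Summable fun ν : ℕ => 1 / (ν : ℂ) ^ 2 * g ν := by
  have h := (Real.summable_one_div_nat_pow.2 one_lt_two).mul_right B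
  refine Summable.of_norm_bounded h fun ν => ?_
  rw [norm_mul, norm_div, norm_one, norm_pow, Complex.norm_natCast]
  gcongr
  exact hg ν

lemma norm_second_order_le (hx : 0 < x) (c : ℂ) (μ : ℤ) :
    ‖c * (((s + 1) * ∫ u in Ioi x, wave α μ (s + 1 + 1) u) - wave α μ (s + 1) x)‖ ≤
      ‖c‖ * (‖s + 1‖ * (∫ u in Ioi x, u ^ (-(s + 1 + 1).re)) + x ^ (-(s + 1).re)) := by
  rw [norm_mul]
  gcongr
  refine (norm_sub_le _ _).trans ?_
  rw [norm_mul, norm_wave _ _ _ hx]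
  gcongr
  exact norm_integral_wave_le_integral α μ _ hx

lemma summable_upperTerm (hσ : 0 < s.re) (hx : 0 < x) : Summable (upperTerm s α x) := by
  exact (summable_inv_sq_mul fun ν => norm_second_order_le hx _ _).congr
    fun ν => (upperTerm_eq_second_order hσ hx ν).symm

lemma summable_upperTermNeg (hσ : 0 < s.re) (hx : 0 < x) : Summable (upperTermNeg s α x) := by
  exact (summable_inv_sq_mul fun ν => norm_second_order_le hx _ _).congr
    fun ν => (upperTermNeg_eq_second_order hσ hx ν).symm

lemma hasSum_periodicBernoulliTwo (v : ℝ) :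
    HasSum (fun n : ℕ => 1 / (n : ℝ) ^ 2 * Real.cos (2 * π * n * v))
      (π ^ 2 * periodicBernoulliTwo v) := by
  have h := hasSum_one_div_nat_pow_mul_cos one_ne_zero
    (x := Int.fract v) ⟨Int.fract_nonneg v, (Int.fract_lt_one v).le⟩
  convert! h using 1
  · funext n
    rw [mul_one]
    congr 1
    rw [Int.fract, show 2 * π * n * (v - ⌊v⌋) =
      2 * π * n * v - ((n * ⌊v⌋ : ℤ) : ℝ) * (2 * π) by push_cast; ring,
      Real.cos_sub_int_mul_two_pi]
  · have hb : (Polynomial.map (algebraMap ℚ ℝ) (Polynomial.bernoulli (2 * 1))).eval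
        (Int.fract v) = Int.fract v ^ 2 - Int.fract v + 6⁻¹ := bernoulliFun_two _
    rw [hb, periodicBernoulliTwo]
    rw [mul_one, Nat.factorial_two]
    push_cast
    ring

lemma hasSum_wave_add_wave_neg (α : ℝ) (w : ℂ) (u : ℝ) :
    HasSum (fun ν : ℕ => 1 / (ν : ℂ) ^ 2 * (wave α (ν : ℤ) w u + wave α (-(ν : ℤ)) w u))
      (2 * π ^ 2 * ((periodicBernoulliTwo (u - α) : ℂ) * (u : ℂ) ^ (-w))) := by
  have h := ((Complex.hasSum_ofReal.2 (hasSum_periodicBernoulliTwo (u - α))).mul_right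
    (2 * (u : ℂ) ^ (-w)))
  convert! h using 1
  · funext ν
    rw [wave_eq_mul_cpow, wave_eq_mul_cpow]
    push_cast
    rw [Complex.cos]
    have e1 : 2 * (π : ℂ) * Complex.I * (ν : ℂ) * ((u : ℂ) - α) =
      2 * π * ν * (u - α) * Complex.I := by ring
    have e2 : 2 * (π : ℂ) * Complex.I * (-(ν : ℂ)) * ((u : ℂ) - α) =
      -(2 * π * ν * (u - α)) * Complex.I := by ring
    rw [e1, e2]
    ring
  · push_cast
    ring

lemma hasSum_integral_wave (hσ : 0 < s.re) (hx : 0 < x) :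
    HasSum (fun ν : ℕ => 1 / (ν : ℂ) ^ 2 * ((∫ u in Ioi x, wave α (ν : ℤ) (s + 1 + 1) u) +
      ∫ u in Ioi x, wave α (-(ν : ℤ)) (s + 1 + 1) u)) (2 * π ^ 2 * bernoulliIntegral s α x) := by
  have hw : 1 < (s + 1 + 1).re := by simp; linarith
  have hint : ∀ μ : ℤ, IntegrableOn (wave α μ (s + 1 + 1)) (Ioi x) :=
    fun μ => integrableOn_wave_Ioi α μ hw hx
  have hF : ∀ ν : ℕ, IntegrableOn (fun u => 1 / (ν : ℂ) ^ 2 *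
      (wave α (ν : ℤ) (s + 1 + 1) u + wave α (-(ν : ℤ)) (s + 1 + 1) u)) (Ioi x) :=
    fun ν => ((hint _).add (hint _)).const_mul _
  have hpi : IntegrableOn (fun u : ℝ => 2 * u ^ (-(s + 1 + 1).re)) (Ioi x) :=
    (integrableOn_Ioi_rpow_of_lt (by linarith) hx).const_mul 2
  have hsum : Summable fun ν : ℕ => ∫ u in Ioi x, ‖1 / (ν : ℂ) ^ 2 *
      (wave α (ν : ℤ) (s + 1 + 1) u + wave α (-(ν : ℤ)) (s + 1 + 1) u)‖ := by
    refine Summable.of_nonneg_of_le (fun ν => integral_nonneg fun u => norm_nonneg _) (fun ν => ?_)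
      ((Real.summable_one_div_nat_pow.2 one_lt_two).mul_right
        (∫ u in Ioi x, 2 * u ^ (-(s + 1 + 1).re)))
    rw [← integral_const_mul]
    refine setIntegral_mono_on (hF ν).norm (hpi.const_mul _) measurableSet_Ioi fun u hu => ?_
    have hu0 : 0 < u := hx.trans hu
    rw [norm_mul, norm_div, norm_one, norm_pow, Complex.norm_natCast]
    gcongr
    refine (norm_add_le _ _).trans (le_of_eq ?_)
    rw [norm_wave _ _ _ hu0, norm_wave _ _ _ hu0]
    ring
  have h := hasSum_integral_of_summable_integral_norm hF hsum
  convert! h using 1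
  · funext ν
    rw [integral_const_mul, integral_add (hint _) (hint _)]
  · rw [bernoulliIntegral, ← integral_const_mul]
    congr 1
    funext u
    rw [(hasSum_wave_add_wave_neg α (s + 1 + 1) u).tsum_eq]
    congr 3
    ring

lemma tsum_upperTerm_sub_tsum_upperTermNeg (hσ : 0 < s.re) (hx : 0 < x) :
    (∑' ν, upperTerm s α x ν) - ∑' ν, upperTermNeg s α x ν =
      s / 2 * periodicBernoulliTwo (x - α) * (x : ℂ) ^ (-s - 1) -
        s * (s + 1) / 2 * bernoulliIntegral s α x := by
  rw [← (summable_upperTerm hσ hx).tsum_sub (summable_upperTermNeg hσ hx)]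
  have h := (((hasSum_integral_wave (α := α) hσ hx).mul_left (s + 1)).sub
    (hasSum_wave_add_wave_neg α (s + 1) x)).mul_left (-(s / (4 * π ^ 2)))
  have hπC : (π : ℂ) ≠ 0 := by exact_mod_cast Real.pi_ne_zero
  have heq : -(s / (4 * (π : ℂ) ^ 2)) * ((s + 1) * (2 * π ^ 2 * bernoulliIntegral s α x) -
      2 * π ^ 2 * ((periodicBernoulliTwo (x - α) : ℂ) * (x : ℂ) ^ (-(s + 1)))) =
      s / 2 * periodicBernoulliTwo (x - α) * (x : ℂ) ^ (-s - 1) -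
        s * (s + 1) / 2 * bernoulliIntegral s α x := by
    rw [show -(s + 1) = -s - 1 by ring]
    field_simp
    ring
  rw [← heq, ← h.tsum_eq]
  refine tsum_congr fun ν => ?_
  rw [upperTerm_eq_second_order hσ hx, upperTermNeg_eq_second_order hσ hx]
  ring

lemma upperTerm_zero (s : ℂ) (α x : ℝ) : upperTerm s α x 0 = 0 := by simp [upperTerm]

lemma upperTermNeg_zero (s : ℂ) (α x : ℝ) : upperTermNeg s α x 0 = 0 := by simp [upperTermNeg]

theorem hurwitzZeta_eq_add_tsum (hσ : 0 < s.re) (hs1 : s ≠ 1) (hα : 0 < α) (hα1 : α ≤ 1)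
    (hx : 0 < x) :
    HurwitzZeta.hurwitzZeta (α : UnitAddCircle) s =
      mainSum s α x + (x : ℂ) ^ (1 - s) / (s - 1) + psi (x - α) * (x : ℂ) ^ (-s) +
        (∑' ν, upperTerm s α x ν) - ∑' ν : {ν : ℕ // 1 ≤ ν}, upperTermNeg s α x ν := by
  have hneg : ∑' ν : {ν : ℕ // 1 ≤ ν}, upperTermNeg s α x ν = ∑' ν, upperTermNeg s α x ν := by
    refine tsum_subtype_eq_of_support_subset (s := {ν : ℕ | 1 ≤ ν}) fun ν hν => ?_
    refine Nat.one_le_iff_ne_zero.2 ?_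
    rintro rfl
    exact hν (upperTermNeg_zero s α x)
  have h := tsum_upperTerm_sub_tsum_upperTermNeg (α := α) hσ hx
  rw [hurwitzZeta_eq_eulerMaclaurinTwo hσ hs1 hα hα1 hx, eulerMaclaurinTwo, hneg]
  linear_combination -h

end FourierSeries

section Assembly

variable {s : ℂ} {α x y η : ℝ}

/-- The integers `ν ≥ 1` are split at `y` and `y + η`. -/
lemma tsum_upperTerm_eq (hσ : 0 < s.re) (hx : 0 < x) (hy : 0 ≤ y) (hη : 0 < η) :
    ∑' ν, upperTerm s α x ν =
      (∑ ν ∈ Finset.Icc 1 ⌊y⌋₊, upperTerm s α x ν) +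
        (∑ ν ∈ Finset.Icc 1 ⌈y + η⌉₊ with y < ((ν : ℕ) : ℝ) ∧ ((ν : ℕ) : ℝ) < y + η,
          upperTerm s α x ν) +
        ∑' ν : {ν : ℕ // 1 ≤ ν ∧ y + η ≤ (ν : ℝ)}, upperTerm s α x ν := by
  set A := Finset.Icc 1 ⌊y⌋₊ with hA
  set B := (Finset.Icc 1 ⌈y + η⌉₊).filter (fun ν : ℕ => y < (ν : ℝ) ∧ (ν : ℝ) < y + η) with hB
  have hmemA : ∀ ν : ℕ, ν ∈ A ↔ 1 ≤ ν ∧ (ν : ℝ) ≤ y := fun ν => by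
    rw [hA, Finset.mem_Icc, Nat.le_floor_iff hy]
  have hmemB : ∀ ν : ℕ, ν ∈ B ↔ 1 ≤ ν ∧ y < (ν : ℝ) ∧ (ν : ℝ) < y + η := fun ν => by
    rw [hB, Finset.mem_filter, Finset.mem_Icc]
    constructor
    · rintro ⟨⟨h1, -⟩, h2⟩; exact ⟨h1, h2⟩
    · rintro ⟨h1, h2⟩
      exact ⟨⟨h1, by exact_mod_cast (h2.2.trans_le (Nat.le_ceil _)).le⟩, h2⟩
  have hdisj : Disjoint A B := Finset.disjoint_left.2 fun ν h1 h2 => by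
    rw [hmemA] at h1
    rw [hmemB] at h2
    linarith [h1.2, h2.2.1]
  rw [← (summable_upperTerm hσ hx).sum_add_tsum_subtype_compl (A ∪ B), Finset.sum_union hdisj]
  congr 1
  have e1 := tsum_subtype {ν : ℕ | ν ∉ A ∪ B} (upperTerm s α x)
  have e2 := tsum_subtype {ν : ℕ | 1 ≤ ν ∧ y + η ≤ (ν : ℝ)} (upperTerm s α x)
  refine e1.trans (Eq.trans ?_ e2.symm)
  refine tsum_congr fun ν => ?_
  rcases Nat.eq_zero_or_pos ν with rfl | hν
  · simp [indicator, upperTerm_zero]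
  · have hiff : ν ∈ {ν : ℕ | ν ∉ A ∪ B} ↔ ν ∈ {ν : ℕ | 1 ≤ ν ∧ y + η ≤ (ν : ℝ)} := by
      simp only [mem_ofPred_eq, Finset.mem_union, hmemA, hmemB, not_or, not_and, not_le, not_lt]
      constructor
      · rintro ⟨h1, h2⟩
        exact ⟨hν, h2 hν (h1 hν)⟩
      · rintro ⟨h1, h2⟩
        exact ⟨fun _ => by linarith, fun _ _ => h2⟩
    by_cases h : ν ∈ {ν : ℕ | ν ∉ A ∪ B}
    · rw [indicator_of_mem h, indicator_of_mem (hiff.1 h)]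
    · rw [indicator_of_notMem h, indicator_of_notMem (fun h' => h (hiff.2 h'))]

theorem hurwitzZeta_sub_eq_K1_add_K2 (hσ : 0 < s.re) (hσ1 : s.re < 1) (hα : 0 < α) (hα1 : α ≤ 1)
    (hx : 0 < x) (hy : 0 ≤ y) (hη : 0 < η) :
    HurwitzZeta.hurwitzZeta (α : UnitAddCircle) s - mainSum s α x - dualSum s α y -
      (x : ℂ) ^ (1 - s) / (s - 1) = K1 s α x y η + K2 s α x y η := by
  have hs1 : s ≠ 1 := by rintro rfl; simp at hσ1
  have hlow : ∑ ν ∈ Finset.Icc 1 ⌊y⌋₊, lowerTerm s α x ν =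
      (∑ ν ∈ Finset.Icc 1 ⌊y⌋₊ with ((ν : ℕ) : ℝ) ≤ y - η, lowerTerm s α x ν) +
        ∑ ν ∈ Finset.Icc 1 ⌊y⌋₊ with y - η < ((ν : ℕ) : ℝ), lowerTerm s α x ν := by
    rw [← Finset.sum_filter_add_sum_filter_not _ (fun ν : ℕ => (ν : ℝ) ≤ y - η)]
    simp only [not_le]
  have hup : ∑ ν ∈ Finset.Icc 1 ⌊y⌋₊, upperTerm s α x ν =
      (boundaryTerm s α x ⌊y⌋₊ - psi (x - α) * (x : ℂ) ^ (-s)) -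
        (∑ ν ∈ Finset.Icc 1 ⌊y⌋₊, lowerTerm s α x ν) + dualSum s α y := by
    rw [Finset.sum_congr rfl fun ν hν => upperTerm_eq hσ hσ1 hx (Finset.mem_Icc.1 hν).1,
      Finset.sum_add_distrib, Finset.sum_sub_distrib, ← Finset.mul_sum, ← Finset.mul_sum,
      boundaryTerm, dualSum]
    ring
  rw [hurwitzZeta_eq_add_tsum hσ hs1 hα hα1 hx, tsum_upperTerm_eq hσ hx hy hη, hup, hlow, K1, K2]
  ring

end Assembly

end HurwitzAFE

theorem proposition1 :
    -- the approximate functional equation with its explicit remainder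
    (∀ (s : ℂ) (α x y η : ℝ), 0 < s.re → s.re < 1 → 0 ≤ s.im → 0 < α → α ≤ 1 →
      0 < x → y = s.im / (2 * π * x) → 0 < η → η < 1 →
      -- the integrals and the two infinite series in the remainder converge absolutely
      ((∀ ν : ℤ, MeasureTheory.IntegrableOn (HurwitzAFE.wave α ν (s + 1)) (Set.Ioi x)) ∧
        (∀ ν : ℤ, IntervalIntegrable (HurwitzAFE.wave α ν s) MeasureTheory.volume 0 x) ∧
        (Summable fun ν : {ν : ℕ // 1 ≤ ν} => HurwitzAFE.upperTerm s α x ν) ∧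
        (Summable fun ν : {ν : ℕ // 1 ≤ ν} => HurwitzAFE.upperTermNeg s α x ν)) ∧
      ∃ E₁ : ℂ,
        HurwitzZeta.hurwitzZeta (α : UnitAddCircle) s =
          HurwitzAFE.mainSum s α x + HurwitzAFE.dualSum s α y + E₁ ∧
        E₁ - (x : ℂ) ^ (1 - s) / (s - 1) =
          HurwitzAFE.K1 s α x y η + HurwitzAFE.K2 s α x y η ∧
        (∀ ν₀ : ℕ, 1 ≤ ν₀ → y = (ν₀ : ℝ) →
          E₁ - (x : ℂ) ^ (1 - s) / (s - 1) =
            HurwitzAFE.K1Int s α x ν₀ + HurwitzAFE.K2Int s α x ν₀)) ∧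
    -- the estimates, uniform in `s`, `α` and in `x, y ≥ c`
    (∀ η c : ℝ, 0 < η → η < 1 → 0 < c → ∃ C : ℝ, ∀ (s : ℂ) (α x y : ℝ),
      0 < s.re → s.re < 1 → 0 ≤ s.im → 0 < α → α ≤ 1 →
      y = s.im / (2 * π * x) → c ≤ x → c ≤ y →
        ‖HurwitzAFE.K1 s α x y η‖ ≤ C * (x ^ (-s.re) * Real.log (s.im + 2)) ∧
        ‖HurwitzAFE.K2 s α x y η‖ ≤ C * (x ^ (1 - s.re) / √s.im)) ∧
    -- the same estimates for the special form when `y = ν₀` is a positive integer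
    (∀ c : ℝ, 0 < c → ∃ C : ℝ, ∀ (s : ℂ) (α x y : ℝ) (ν₀ : ℕ),
      0 < s.re → s.re < 1 → 0 ≤ s.im → 0 < α → α ≤ 1 →
      y = s.im / (2 * π * x) → 1 ≤ ν₀ → y = (ν₀ : ℝ) → c ≤ x →
        ‖HurwitzAFE.K1Int s α x ν₀‖ ≤ C * (x ^ (-s.re) * Real.log (s.im + 2)) ∧
        ‖HurwitzAFE.K2Int s α x ν₀‖ ≤ C * (x ^ (1 - s.re) / √s.im)) := by
  have hbound : ∀ η c : ℝ, 0 < η → η < 1 → 0 < c → ∃ C : ℝ, ∀ (s : ℂ) (α x y : ℝ),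
      0 < s.re → s.re < 1 → 0 ≤ s.im → 0 < α → α ≤ 1 →
      y = s.im / (2 * π * x) → c ≤ x → c ≤ y →
        ‖HurwitzAFE.K1 s α x y η‖ ≤ C * (x ^ (-s.re) * Real.log (s.im + 2)) ∧
        ‖HurwitzAFE.K2 s α x y η‖ ≤ C * (x ^ (1 - s.re) / √s.im) := by
    intro η c hη hη1 hc
    refine ⟨max ((2 + (1 + 1 / c ^ 2) * (1 / η) + 2 / η + (1 + 1 / c ^ 2)) *
      (2 * (1 + 1 / c) + 3)) (3 * (1 + 1 / c ^ 2) + (2 / c + 2 * c)), ?_⟩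
    intro s α x y hσ hσ1 ht _ _ hy hcx hcy
    have hx : 0 < x := hc.trans_le hcx
    have hyt : s.im = 2 * π * x * y := by
      rw [hy, mul_div_cancel₀]
      have := Real.pi_pos
      positivity
    constructor
    · refine (HurwitzAFE.norm_K1_le hη hη1 hσ hσ1 hc hcx hcy hyt).trans ?_
      refine mul_le_mul_of_nonneg_right (le_max_left _ _) ?_
      exact mul_nonneg (Real.rpow_nonneg hx.le _) (Real.log_nonneg (by linarith))
    · refine (HurwitzAFE.norm_K2_le hη1 hσ hσ1 hc hcx hcy hyt).trans ?_
      exact mul_le_mul_of_nonneg_right (le_max_right _ _) (by positivity)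
  refine ⟨?_, hbound, ?_⟩
  · intro s α x y η hσ hσ1 ht hα hα1 hx hy hη _
    have hy0 : 0 ≤ y := by
      have := Real.pi_pos
      rw [hy]; positivity
    refine ⟨⟨fun ν => HurwitzAFE.integrableOn_wave_Ioi α ν (by simpa using hσ) hx,
      fun ν => HurwitzAFE.intervalIntegrable_wave α ν hσ1 0 x,
      (HurwitzAFE.summable_upperTerm hσ hx).subtype _,
      (HurwitzAFE.summable_upperTermNeg hσ hx).subtype _⟩,
      HurwitzZeta.hurwitzZeta (α : UnitAddCircle) s - HurwitzAFE.mainSum s α x -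
        HurwitzAFE.dualSum s α y, by ring,
      HurwitzAFE.hurwitzZeta_sub_eq_K1_add_K2 hσ hσ1 hα hα1 hx hy0 hη, ?_⟩
    intro ν₀ hν₀ hyν
    rw [HurwitzAFE.K1Int_eq, HurwitzAFE.K2Int_eq s α x hν₀, ← hyν]
    exact HurwitzAFE.hurwitzZeta_sub_eq_K1_add_K2 hσ hσ1 hα hα1 hx hy0 one_half_pos
  · intro c hc
    -- here `y = ν₀ ≥ 1`, so that `min c 1` bounds both `x` and `y` from below
    obtain ⟨C, hC⟩ := hbound (1 / 2) (min c 1) one_half_pos one_half_lt_one (lt_min hc one_pos)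
    refine ⟨C, fun s α x y ν₀ hσ hσ1 ht hα hα1 hy hν₀ hyν hcx => ?_⟩
    have h1 : (1 : ℝ) ≤ y := by rw [hyν]; exact_mod_cast hν₀
    rw [HurwitzAFE.K1Int_eq, HurwitzAFE.K2Int_eq s α x hν₀, ← hyν]
    exact hC s α x y hσ hσ1 ht hα hα1 hy ((min_le_left _ _).trans hcx) ((min_le_right _ _).trans h1)
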